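/- Let $k$ be a field and $A$ a finite-dimensional $k$-algebra with a complete set of orthogonal idempotents $e_i$ ($i\in I$, $I$ finite). Suppose that $A$ is \emph{Reedy}: there are a function $\deg\colon I\to\mathbb N$ and subalgebras $A^+,A^-\subseteq A$, both containing all $e_i$, such that - $e_iA^+e_i\cong k$ for all $i$ and, for $i\ne j$, $e_jA^+e_i\neq0$ implies $\deg(j)>\deg(i)$; - $e_iA^-e_i\cong k$ for all $i$ and, for $i\ne j$, $e_jA^-e_i\neq0$ implies $\deg(j)<\deg(i)$; - for all $i,j$ multiplication induces an isomorphism $\bigoplus_{l\in I} e_jA^+e_l\otimes_k e_lA^-e_i\to e_jAe_i$ of $k$-vector spaces (in other words, $A^+\otimes_{A^0}A^-\cong A$ for $A^0=A^+\cap A^-=\bigoplus_i k e_i$). For modules $P,M$ let $\operatorname{Tr}_PM$ be the submodule of $M$ generated by the images of all homomorphisms $P\to M$. Then each left $A$-module $Ae_i/\sum_{\deg(j)<\deg(i)}\operatorname{Tr}_{Ae_j}Ae_i$ has a unique maximal submodule; let $L(i)$ be its simple quotient. Order $I$ by $i\lhd j$ if and only if $\deg(i)>\deg(j)$, and let $i\unlhd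 j$ mean $i=j$ or $i\lhd j$. Then $(A,\unlhd)$, with the simple modules $L(i)$, is quasi-hereditary, and $A^-$ is an exact Borel subalgebra of $A$. Here $(A,\unlhd)$ is quasi-hereditary if the $L(i)$, $i\in I$, represent each isomorphism class of simple left $A$-modules exactly once and, writing $P(i)$ for the projective cover of $L(i)$ and $\Delta(i)=P(i)/\sum_{j\not\unlhd i}\operatorname{Tr}_{P(j)}P(i)$ for the standard modules, for every $i$ the kernel of the canonical surjection $\Delta(i)\to L(i)$ has a finite filtration with factors of the form $L(j)$, $j\lhd i$, and the kernel of $P(i)\to\Delta(i)$ has a finite filtration with factors of the form $\Delta(j)$, $j\rhd i$. A subalgebra $B$ of $A$ is an exact Borel subalgebra if its simple left modules can be indexed, up to isomorphism, as $S(i)$, $i\in I$, such that $(B,\unlhd)$ is quasi-hereditary with simple standard modules, the functor $A\otimes_B-$ is exact, and $\Delta(i)\cong A\otimes_BS(i)$ for all $i\in I$. -/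

import Mathlib

open scoped TensorProduct

universe u v w

namespace ReedyAlg

section Modules

/-- The trace of `P` in `M`: the submodule of `M` generated by the images of all homomorphisms
`P → M`. -/
def traceSubmodule (A : Type*) [Ring A] (P M : Type*) [AddCommGroup P] [Module A P]
    [AddCommGroup M] [Module A M] : Submodule A M :=
  ⨆ f : P →ₗ[A] M, LinearMap.range f

/-- `p : P → M` is a projective cover: `P` is projective, and `p` is surjective with superfluous
kernel. -/
structure IsProjectiveCover {A : Type*} [Ring A] {P M : Type*} [AddCommGroup P] [Module A P]
    [AddCommGroup M] [Module A M] (p : P →ₗ[A] M) : Prop where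
  projective : Module.Projective A P
  surjective : Function.Surjective p
  superfluous : ∀ N : Submodule A P, N ⊔ LinearMap.ker p = ⊤ → N = ⊤

/-- `M` has a finite filtration `0 = N 0 ⊆ N 1 ⊆ ⋯ ⊆ N n = M` in which every factor is isomorphic
to some `F j` with `j ∈ s` (the case `n = 0` is allowed and means `M = 0`). -/
def IsFilteredBy {A : Type*} [Ring A] (M : Type*) [AddCommGroup M] [Module A M] {Λ : Type*}
    (F : Λ → Type*) [∀ j, AddCommGroup (F j)] [∀ j, Module A (F j)] (s : Set Λ) : Prop :=
  ∃ (n : ℕ) (N : ℕ → Submodule A M), Monotone N ∧ N 0 = ⊥ ∧ N n = ⊤ ∧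
    ∀ m < n, ∃ j ∈ s,
      Nonempty ((↥(N (m + 1)) ⧸ (N m).comap (N (m + 1)).subtype) ≃ₗ[A] F j)

/-- `L` is a family of representatives of the isomorphism classes of simple left `A`-modules,
each class being represented exactly once. -/
structure IsCompleteSimpleFamily {A : Type v} [Ring A] {Λ : Type w}
    (L : Λ → ModuleCat.{v} A) : Prop where
  simple : ∀ i, IsSimpleModule A (L i)
  unique : ∀ i j, Nonempty (L i ≃ₗ[A] L j) → i = j
  exhaust : ∀ (M : Type v) [AddCommGroup M] [Module A M], IsSimpleModule A M →
    ∃ i, Nonempty (M ≃ₗ[A] L i)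

/-- The submodule `∑_{j ⋬ i} Tr_{P j} (P i)` of `P i`. -/
def standardKernel {A : Type v} [Ring A] {Λ : Type w} (ord : PartialOrder Λ)
    (P : Λ → ModuleCat.{v} A) (i : Λ) : Submodule A (P i) :=
  ⨆ j : Λ, ⨆ _ : ¬ ord.le j i, traceSubmodule A (P j) (P i)

/-- The standard module `Δ(i) = P(i) / ∑_{j ⋬ i} Tr_{P(j)} P(i)`. -/
abbrev Standard {A : Type v} [Ring A] {Λ : Type w} (ord : PartialOrder Λ)
    (P : Λ → ModuleCat.{v} A) (i : Λ) : Type v :=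
  P i ⧸ standardKernel ord P i

end Modules

section QuasiHereditary

/-- The conditions for `(A, ⊴)` to be quasi-hereditary, expressed with the simple modules `L i`
and chosen projective covers `p i : P i → L i`. -/
structure IsQuasiHereditaryWith {A : Type v} [Ring A] {Λ : Type w} (ord : PartialOrder Λ)
    (L P : Λ → ModuleCat.{v} A) (p : ∀ i, P i →ₗ[A] L i) : Prop where
  simples : IsCompleteSimpleFamily L
  cover : ∀ i, IsProjectiveCover (p i)
  /-- `p i` factors through the canonical surjection `q : Δ(i) → L(i)`, whose kernel is filtered
  by the `L j` with `j ◁ i`. -/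
  kernel_to_simple : ∀ i, ∃ q : Standard ord P i →ₗ[A] L i,
    q ∘ₗ (standardKernel ord P i).mkQ = p i ∧
    IsFilteredBy (A := A) (LinearMap.ker q) (fun j => L j) {j | ord.lt j i}
  /-- The kernel of `P(i) → Δ(i)` is filtered by the `Δ(j)` with `i ◁ j`. -/
  kernel_to_standard : ∀ i,
    IsFilteredBy (A := A) (standardKernel ord P i) (fun j => Standard ord P j) {j | ord.lt i j}

/-- `(A, ⊴)`, with simple modules `L i`, is quasi-hereditary. Since projective covers are unique
up to isomorphism, the condition does not depend on their choice. -/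
def IsQuasiHereditary {A : Type v} [Ring A] {Λ : Type w} (ord : PartialOrder Λ)
    (L : Λ → ModuleCat.{v} A) : Prop :=
  ∃ (P : Λ → ModuleCat.{v} A) (p : ∀ i, P i →ₗ[A] L i), IsQuasiHereditaryWith ord L P p

end QuasiHereditary

section Induction

variable {k : Type u} {A : Type v} [Field k] [Ring A] [Algebra k A]

/-- The `A`-submodule of `A ⊗_ℤ M` generated by the elements `ab ⊗ m - a ⊗ bm` with `b ∈ B`. -/
def balancingSubmodule (B : Subalgebra k A) (M : Type w) [AddCommGroup M] [Module B M] :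
    Submodule A (A ⊗[ℤ] M) :=
  Submodule.span A {x | ∃ (a : A) (b : B) (m : M), x = (a * (b : A)) ⊗ₜ[ℤ] m - a ⊗ₜ[ℤ] (b • m)}

/-- The left `A`-module `A ⊗_B M` for a (not necessarily commutative) subalgebra `B` of `A` and a
left `B`-module `M`. -/
abbrev Induced (B : Subalgebra k A) (M : Type w) [AddCommGroup M] [Module B M] : Type (max v w) :=
  (A ⊗[ℤ] M) ⧸ balancingSubmodule B M

/-- The map `A ⊗_B f`. -/
def Induced.map (B : Subalgebra k A) {M N : Type w} [AddCommGroup M] [Module B M]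
    [AddCommGroup N] [Module B N] (f : M →ₗ[B] N) : Induced B M →ₗ[A] Induced B N :=
  Submodule.mapQ (balancingSubmodule B M) (balancingSubmodule B N)
    (TensorProduct.AlgebraTensorModule.map (LinearMap.id : A →ₗ[A] A)
      f.toAddMonoidHom.toIntLinearMap) (by
    refine Submodule.span_le.2 ?_
    rintro x ⟨a, b, m, rfl⟩
    refine Submodule.subset_span ⟨a, b, f m, ?_⟩
    simp)

/-- The induction functor `A ⊗_B -` is exact. -/
def InductionIsExact (B : Subalgebra k A) : Prop :=
  ∀ (M N Q : Type v) [AddCommGroup M] [AddCommGroup N] [AddCommGroup Q]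
    [Module B M] [Module B N] [Module B Q] (f : M →ₗ[B] N) (g : N →ₗ[B] Q),
    Function.Injective f → Function.Exact f g → Function.Surjective g →
      Function.Injective (Induced.map B f) ∧
      Function.Exact (Induced.map B f) (Induced.map B g) ∧
      Function.Surjective (Induced.map B g)

/-- `B` is an exact Borel subalgebra of the quasi-hereditary algebra `(A, ⊴)` with simple modules
`L i`: the simple `B`-modules can be indexed as `S i` by the same set so that `(B, ⊴)` is
quasi-hereditary with simple standard modules, `A ⊗_B -` is exact, and
`Δ(i) ≅ A ⊗_B S(i)` for all `i`. -/
def IsExactBorel {Λ : Type w} (ord : PartialOrder Λ) (L : Λ → ModuleCat.{v} A)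
    (B : Subalgebra k A) : Prop :=
  ∃ (P : Λ → ModuleCat.{v} A) (p : ∀ i, P i →ₗ[A] L i)
    (S Q : Λ → ModuleCat.{v} B) (q : ∀ i, Q i →ₗ[B] S i),
    IsQuasiHereditaryWith ord L P p ∧
    IsQuasiHereditaryWith ord S Q q ∧
    (∀ i, IsSimpleModule B (Standard ord Q i)) ∧
    InductionIsExact B ∧
    ∀ i, Nonempty (Standard ord P i ≃ₗ[A] Induced B (S i))

end Induction

section Reedy

/-- The subspace `x S y = {x s y | s ∈ S}` of `A`. -/
def corner {k : Type u} {A : Type v} [Field k] [Ring A] [Algebra k A] (S : Subalgebra k A)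
    (x y : A) : Submodule k A :=
  (Subalgebra.toSubmodule S).map (LinearMap.mulLeftRight k (x, y))

/-- The map `⨁ l, e_j A⁺ e_l ⊗_k e_l A⁻ e_i → A` induced by multiplication. -/
noncomputable def triangularMul {k : Type u} {A : Type v} [Field k] [Ring A] [Algebra k A]
    {ι : Type w} [Fintype ι] (e : ι → A) (Ap Am : Subalgebra k A) (i j : ι) :
    (∀ l : ι, ↥(corner Ap (e j) (e l)) ⊗[k] ↥(corner Am (e l) (e i))) →ₗ[k] A :=
  ∑ l, Submodule.mulMap (corner Ap (e j) (e l)) (corner Am (e l) (e i)) ∘ₗ LinearMap.proj l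

/-- The algebra `A` is Reedy with respect to the complete set of orthogonal idempotents `e i`, the
degree function `deg` and the subalgebras `Ap = A⁺` and `Am = A⁻`. -/
structure IsReedy {k : Type u} {A : Type v} [Field k] [Ring A] [Algebra k A]
    {ι : Type w} [Fintype ι] (e : ι → A) (deg : ι → ℕ) (Ap Am : Subalgebra k A) : Prop where
  idem : CompleteOrthogonalIdempotents e
  mem_plus : ∀ i, e i ∈ Ap
  mem_minus : ∀ i, e i ∈ Am
  plus_diag : ∀ i, Nonempty (↥(corner Ap (e i) (e i)) ≃ₗ[k] k)
  plus_deg : ∀ i j, i ≠ j → corner Ap (e j) (e i) ≠ ⊥ → deg i < deg j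
  minus_diag : ∀ i, Nonempty (↥(corner Am (e i) (e i)) ≃ₗ[k] k)
  minus_deg : ∀ i j, i ≠ j → corner Am (e j) (e i) ≠ ⊥ → deg j < deg i
  mul_injective : ∀ i j, Function.Injective (triangularMul e Ap Am i j)
  mul_range : ∀ i j, LinearMap.range (triangularMul e Ap Am i j) = corner ⊤ (e j) (e i)

/-- The partial order `⊴` with `i ◁ j` if and only if `deg j < deg i`. -/
@[reducible] def weightOrder {ι : Type w} (deg : ι → ℕ) : PartialOrder ι where
  le i j := i = j ∨ deg j < deg i
  lt i j := deg j < deg i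
  le_refl _ := Or.inl rfl
  le_trans := by grind
  lt_iff_le_not_ge := by grind
  le_antisymm := by grind

/-- The submodule `∑_{deg e_j < deg e_i} Tr_{A e_j} A e_i` of the left ideal `A e_i`. -/
def degreeTrace {A : Type v} [Ring A] {ι : Type w} (e : ι → A) (deg : ι → ℕ) (i : ι) :
    Submodule A ↥(Submodule.span A {e i}) :=
  ⨆ j : ι, ⨆ _ : deg j < deg i,
    traceSubmodule A ↥(Submodule.span A {e j}) ↥(Submodule.span A {e i})

/-- The module `A e_i / ∑_{deg e_j < deg e_i} Tr_{A e_j} A e_i`. -/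
abbrev DegreeStandard {A : Type v} [Ring A] {ι : Type w} (e : ι → A) (deg : ι → ℕ) (i : ι) :
    Type v :=
  ↥(Submodule.span A {e i}) ⧸ degreeTrace e deg i

/-- `L(i)`, the quotient of `DegreeStandard e deg i` by its radical. For a Reedy algebra
it is the unique simple quotient of that module. -/
noncomputable abbrev degreeSimple {A : Type v} [Ring A] {ι : Type w} (e : ι → A) (deg : ι → ℕ)
    (i : ι) : ModuleCat.{v} A :=
  ModuleCat.of A
    (DegreeStandard e deg i ⧸ Module.jacobson A (DegreeStandard e deg i))

end Reedy

end ReedyAlg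

/-!
Let `t` run through `k`-bases of the spaces `e j A⁺ e l`. The triangular decomposition says that
every element of `A` is uniquely a sum `∑ t b * c b` with `c b ∈ e (l b) A⁻`; such a family,
together with the degree conditions, is called a triangular basis (`IsTriangularBasis`,
`IsReedy.isTriangularBasis`). Everything is deduced from it.

Write `I d` for the ideal generated by the idempotents of degree less than `d`. In coordinates,
`I d` consists of the elements whose coefficients vanish at all `b` with `d ≤ deg (l b)`
(`IsTriangularBasis.mem_lowerTrace_iff`). Modulo `I (deg i)`, therefore, `A e i` becomes `A⁺ e i`:
its part at `e i` is the line through `e i`, and its other parts sit in degrees larger than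
`deg i`. Moreover, modulo `I d`, the products `A e l ⊗ e l A → A` with `deg l = d` are jointly
injective. These facts make up `IsStratified`, and they give quasi-heredity:

* The module `Δ(i) = A e i / I (deg i) e i` has one-dimensional `e i`-part, which generates it, so
  it has a greatest proper submodule. A simple module is determined by the vertex of least degree
  at which it does not vanish.
* The idempotent `e i` need not be primitive. The projective cover of `L(i)` is `A f i` for an
  idempotent `f i ∈ e i A e i` with `f i ≡ e i` modulo `I (deg i)`, found in a minimal left ideal
  (`IsStratified.exists_primitive`). The ideals generated by the `e j` and by the `f j` with
  `deg j < d` agree, so that the standard module of `A f i` is `Δ(i)`.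
* In any left ideal `A f` with `f` idempotent, homogeneous elements that form a basis modulo `I d`
  of the parts of degree `d` generate a direct sum of copies of the `Δ(l)` with `deg l = d`, by
  the injectivity of multiplication; adjoining them one at a time filters the layer between `I d`
  and `I (d + 1)` (`IsStratified.chain_layer`).

Filtrations are built from steps `N ⊆ N + A x` with prescribed annihilator of `x` modulo `N`
(`CyclicStep`), as all the factors are cyclic.

For the Borel part, the idempotents are a triangular basis of `A⁻` over itself, so that the same
argument shows that `A⁻` is quasi-hereditary, with standard modules spanned by the class of `e i`
and hence simple. The coordinates make `A` a direct sum of direct summands of the right module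
`A⁻`, so induction is exact (`IsTriangularBasis.inductionIsExact`). Finally `1 ⊗ g`, with `g` a
generator of the simple `A⁻`-module at `i`, has the same annihilator as the generator of `Δ(i)`
(`IsTriangularBasis.nonempty_standard_equiv_induced`).
-/

namespace ReedyAlg

/-! ### Cyclic modules and filtrations with cyclic factors -/

section Cyclic

variable {A : Type*} [Ring A] {M N : Type*} [AddCommGroup M] [Module A M] [AddCommGroup N]
  [Module A N]

theorem toSpanSingleton_surjective {x : M} (hx : Submodule.span A {x} = ⊤) :
    Function.Surjective (LinearMap.toSpanSingleton A M x) := by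
  rw [← LinearMap.range_eq_top, LinearMap.range_toSpanSingleton, hx]

/-- A generator of a cyclic module may be sent to any element that its annihilator kills. -/
theorem exists_linearMap_of_annihilator_le {x : M} {y : N} (hx : Submodule.span A {x} = ⊤)
    (h : ∀ a : A, a • x = 0 → a • y = 0) : ∃ f : M →ₗ[A] N, f x = y := by
  let s := (LinearMap.toSpanSingleton A M x).quotKerEquivOfSurjective
    (toSpanSingleton_surjective hx)
  have hle : LinearMap.ker (LinearMap.toSpanSingleton A M x) ≤
      LinearMap.ker (LinearMap.toSpanSingleton A N y) := h
  refine ⟨(LinearMap.ker (LinearMap.toSpanSingleton A M x)).liftQ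
    (LinearMap.toSpanSingleton A N y) hle ∘ₗ s.symm.toLinearMap, ?_⟩
  have : s.symm x = Submodule.Quotient.mk 1 := by
    rw [LinearEquiv.symm_apply_eq]
    simp [s, LinearMap.quotKerEquivOfSurjective]
  rw [LinearMap.comp_apply, LinearEquiv.coe_coe, this]
  simp

/-- Cyclic modules whose generators have the same annihilator are isomorphic. -/
theorem exists_linearEquiv_of_annihilator_eq {x : M} {y : N} (hx : Submodule.span A {x} = ⊤)
    (hy : Submodule.span A {y} = ⊤) (h : ∀ a : A, a • x = 0 ↔ a • y = 0) :
    ∃ f : M ≃ₗ[A] N, f x = y := by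
  obtain ⟨f, hf⟩ := exists_linearMap_of_annihilator_le hx fun a => (h a).1
  refine ⟨LinearEquiv.ofBijective f ⟨?_, ?_⟩, hf⟩
  · rw [← LinearMap.ker_eq_bot, eq_bot_iff]
    intro z hz
    obtain ⟨a, rfl⟩ := toSpanSingleton_surjective hx z
    rw [LinearMap.mem_ker, LinearMap.toSpanSingleton_apply, map_smul, hf] at hz
    exact (h a).2 hz
  · intro z
    obtain ⟨a, rfl⟩ := toSpanSingleton_surjective hy z
    exact ⟨a • x, by rw [map_smul, hf]; rfl⟩

variable {Λ : Type*} {F : Λ → Type*} [∀ j, AddCommGroup (F j)] [∀ j, Module A (F j)]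

/-- One step of a filtration whose factors are the cyclic modules `F j = A • g j` with `j ∈ s`:
the submodule `N'` arises from `N` by adjoining an element that satisfies, modulo `N`, exactly the
relations of some generator `g j`. -/
def CyclicStep (g : ∀ j, F j) (s : Set Λ) (N N' : Submodule A M) : Prop :=
  ∃ j ∈ s, ∃ x : M, N' = N ⊔ Submodule.span A {x} ∧ ∀ a : A, a • x ∈ N ↔ a • g j = 0

theorem CyclicStep.le {g : ∀ j, F j} {s : Set Λ} {N N' : Submodule A M}
    (h : CyclicStep g s N N') : N ≤ N' := by
  obtain ⟨j, -, x, rfl, -⟩ := h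
  exact le_sup_left

theorem CyclicStep.mono {g : ∀ j, F j} {s t : Set Λ} (hst : s ⊆ t) {N N' : Submodule A M}
    (h : CyclicStep g s N N') : CyclicStep g t N N' := by
  obtain ⟨j, hj, x, h⟩ := h
  exact ⟨j, hst hj, x, h⟩

theorem CyclicStep.comap {g : ∀ j, F j} {s : Set Λ} {P P' : Submodule A M}
    (h : CyclicStep g s P P') (φ : N →ₗ[A] M) (hφ : P' ≤ LinearMap.range φ) :
    CyclicStep g s (P.comap φ) (P'.comap φ) := by
  obtain ⟨j, hj, x, rfl, hx⟩ := h
  obtain ⟨y, rfl⟩ : x ∈ LinearMap.range φ :=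
    hφ (Submodule.mem_sup_right (Submodule.mem_span_singleton_self x))
  refine ⟨j, hj, y, le_antisymm ?_ ?_, fun a => by rw [← hx, Submodule.mem_comap, map_smul]⟩
  · intro z hz
    obtain ⟨p, hp, q, hq, h⟩ := Submodule.mem_sup.1 hz
    obtain ⟨a, rfl⟩ := Submodule.mem_span_singleton.1 hq
    have : z - a • y ∈ P.comap φ := by
      rw [Submodule.mem_comap, map_sub, map_smul, ← h, add_sub_cancel_right]
      exact hp
    rw [← sub_add_cancel z (a • y)]
    exact Submodule.add_mem_sup this
      (Submodule.smul_mem _ _ (Submodule.mem_span_singleton_self y))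
  · refine sup_le (Submodule.comap_mono le_sup_left) ?_
    rw [Submodule.span_singleton_le_iff_mem]
    exact Submodule.mem_sup_right (Submodule.mem_span_singleton_self (φ y))

theorem CyclicStep.exists_quotient_equiv {g : ∀ j, F j} (hg : ∀ j, Submodule.span A {g j} = ⊤)
    {s : Set Λ} {N N' : Submodule A M} (h : CyclicStep g s N N') :
    ∃ j ∈ s, Nonempty ((↥N' ⧸ N.comap N'.subtype) ≃ₗ[A] F j) := by
  obtain ⟨j, hj, x, rfl, hx⟩ := h
  have hmem : x ∈ N ⊔ Submodule.span A {x} :=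
    Submodule.mem_sup_right (Submodule.mem_span_singleton_self x)
  let y : ↥(N ⊔ Submodule.span A {x}) ⧸ N.comap (N ⊔ Submodule.span A {x}).subtype :=
    Submodule.Quotient.mk ⟨x, hmem⟩
  have hy : Submodule.span A {y} = ⊤ := by
    rw [eq_top_iff]
    rintro z -
    obtain ⟨⟨z, hz⟩, rfl⟩ := Submodule.Quotient.mk_surjective _ z
    obtain ⟨p, hp, q, hq, rfl⟩ := Submodule.mem_sup.1 hz
    obtain ⟨a, rfl⟩ := Submodule.mem_span_singleton.1 hq
    refine Submodule.mem_span_singleton.2 ⟨a, ?_⟩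
    rw [← Submodule.Quotient.mk_smul, Submodule.Quotient.eq, Submodule.mem_comap]
    simpa using hp
  obtain ⟨f, -⟩ := exists_linearEquiv_of_annihilator_eq hy (hg j) fun a => by
    rw [← hx, ← Submodule.Quotient.mk_smul, Submodule.Quotient.mk_eq_zero, Submodule.mem_comap]
    rfl
  exact ⟨j, hj, ⟨f⟩⟩

/-- A chain of cyclic steps from `⊥` to the image of an embedding `K → M` filters `K`. -/
theorem isFilteredBy_of_chain {g : ∀ j, F j} (hg : ∀ j, Submodule.span A {g j} = ⊤) {s : Set Λ}
    {K : Type*} [AddCommGroup K] [Module A K] (φ : K →ₗ[A] M) (hφ : Function.Injective φ)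
    (h : Relation.ReflTransGen (CyclicStep g s) ⊥ (LinearMap.range φ)) :
    IsFilteredBy (A := A) K F s := by
  have key : ∀ N' : Submodule A M, Relation.ReflTransGen (CyclicStep g s) ⊥ N' →
      N' ≤ LinearMap.range φ → ∃ (n : ℕ) (N : ℕ → Submodule A K), Monotone N ∧ N 0 = ⊥ ∧
        (∀ m, n ≤ m → N m = N'.comap φ) ∧ ∀ m < n, CyclicStep g s (N m) (N (m + 1)) := by
    intro N' h
    induction h with
    | refl =>
      have : (⊥ : Submodule A M).comap φ = ⊥ := LinearMap.ker_eq_bot.2 hφ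
      exact fun _ => ⟨0, fun _ => ⊥, monotone_const, rfl, fun _ _ => this.symm, by simp⟩
    | @tail P P' _ hstep ih =>
      intro hP'
      obtain ⟨n, N, hmono, h0, hn, hs⟩ := ih (hstep.le.trans hP')
      refine ⟨n + 1, fun m => if m ≤ n then N m else P'.comap φ, ?_, ?_, ?_, ?_⟩
      · intro a b hab
        by_cases hb : b ≤ n
        · simpa [hb, hab.trans hb] using hmono hab
        · by_cases ha : a ≤ n
          · simp only [ha, hb, if_true, if_false]
            exact (hmono ha).trans ((hn n le_rfl).le.trans (Submodule.comap_mono hstep.le))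
          · simp [ha, hb]
      · simpa using h0
      · intro m hm
        simp [show ¬ m ≤ n by omega]
      · intro m hm
        rcases Nat.lt_or_ge m n with hmn | hmn
        · simpa [hmn.le, Nat.succ_le_of_lt hmn] using hs m hmn
        · obtain rfl : m = n := by omega
          simpa [hn m le_rfl] using hstep.comap φ hP'
  obtain ⟨n, N, hmono, h0, hn, hs⟩ := key _ h le_rfl
  refine ⟨n, N, hmono, h0, ?_, fun m hm => (hs m hm).exists_quotient_equiv hg⟩
  rw [hn n le_rfl, eq_top_iff]
  exact fun x _ => ⟨x, rfl⟩

end Cyclic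

/-! ### Traces of idempotents -/

section Trace

variable {A : Type*} [Ring A] {M N : Type*} [AddCommGroup M] [Module A M] [AddCommGroup N]
  [Module A N]

theorem mem_span_idempotent_iff {f : A} (hf : f * f = f) {x : A} :
    x ∈ Submodule.span A {f} ↔ x * f = x := by
  rw [Submodule.mem_span_singleton]
  constructor
  · rintro ⟨a, rfl⟩
    rw [smul_eq_mul, mul_assoc, hf]
  · exact fun h => ⟨x, h⟩

theorem projective_span_idempotent {f : A} (hf : f * f = f) :
    Module.Projective A ↥(Submodule.span A {f}) := by
  refine Module.Projective.of_split (Submodule.span A {f}).subtype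
    ((LinearMap.toSpanSingleton A A f).codRestrict (Submodule.span A {f}) fun a =>
      Submodule.smul_mem _ a (Submodule.mem_span_singleton_self f)) ?_
  ext ⟨x, hx⟩
  exact (mem_span_idempotent_iff hf).1 hx

theorem traceSubmodule_span_idempotent {f : A} (hf : f * f = f) :
    traceSubmodule A ↥(Submodule.span A {f}) M =
      Submodule.span A (Set.range fun m : M => f • m) := by
  apply le_antisymm
  · refine iSup_le fun φ => ?_
    rintro _ ⟨⟨x, hx⟩, rfl⟩
    have : (⟨x, hx⟩ : ↥(Submodule.span A {f})) =
        x • ⟨f, Submodule.mem_span_singleton_self f⟩ :=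
      Subtype.ext ((mem_span_idempotent_iff hf).1 hx).symm
    have h2 : (⟨f, Submodule.mem_span_singleton_self f⟩ : ↥(Submodule.span A {f})) =
        f • ⟨f, Submodule.mem_span_singleton_self f⟩ := Subtype.ext hf.symm
    rw [this, map_smul, h2, map_smul]
    exact Submodule.smul_mem _ _ (Submodule.subset_span ⟨_, rfl⟩)
  · rw [Submodule.span_le]
    rintro _ ⟨m, rfl⟩
    refine Submodule.mem_iSup_of_mem
      (LinearMap.toSpanSingleton A M m ∘ₗ (Submodule.span A {f}).subtype) ?_
    exact ⟨⟨f, Submodule.mem_span_singleton_self f⟩, rfl⟩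

variable {ι : Type*} (e : ι → A) (deg : ι → ℕ)

variable (M) in
/-- The submodule of `M` generated by all `e j • M` with `deg j < d`; for `M = A` this is the
two-sided ideal generated by the idempotents of degree less than `d`. -/
def lowerTrace (d : ℕ) : Submodule A M :=
  Submodule.span A {x | ∃ j, deg j < d ∧ ∃ m : M, x = e j • m}

variable {e deg}

theorem smul_mem_lowerTrace {d : ℕ} {j : ι} (hj : deg j < d) (m : M) :
    e j • m ∈ lowerTrace M e deg d :=
  Submodule.subset_span ⟨j, hj, m, rfl⟩

theorem mul_mem_lowerTrace {d : ℕ} {j : ι} (hj : deg j < d) (m : A) :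
    e j * m ∈ lowerTrace A e deg d :=
  smul_mem_lowerTrace hj m

theorem lowerTrace_mono {d d' : ℕ} (h : d ≤ d') : lowerTrace M e deg d ≤ lowerTrace M e deg d' :=
  Submodule.span_mono fun _ ⟨j, hj, m, hm⟩ => ⟨j, hj.trans_le h, m, hm⟩

@[simp]
theorem lowerTrace_zero : lowerTrace M e deg 0 = ⊥ := by
  simp [lowerTrace]

theorem map_mem_lowerTrace (φ : M →ₗ[A] N) {d : ℕ} {x : M} (hx : x ∈ lowerTrace M e deg d) :
    φ x ∈ lowerTrace N e deg d := by
  have : lowerTrace M e deg d ≤ (lowerTrace N e deg d).comap φ := by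
    refine Submodule.span_le.2 ?_
    rintro _ ⟨j, hj, m, rfl⟩
    rw [SetLike.mem_coe, Submodule.mem_comap, map_smul]
    exact smul_mem_lowerTrace hj _
  exact this hx

theorem mul_mem_lowerTrace_right {d : ℕ} {x : A} (hx : x ∈ lowerTrace A e deg d) (a : A) :
    x * a ∈ lowerTrace A e deg d :=
  map_mem_lowerTrace (LinearMap.toSpanSingleton A A a) hx

theorem smul_mem_lowerTrace_of_mem {d : ℕ} {x : A} (hx : x ∈ lowerTrace A e deg d) (m : M) :
    x • m ∈ lowerTrace M e deg d :=
  map_mem_lowerTrace (LinearMap.toSpanSingleton A M m) hx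

theorem lowerTrace_eq_bot {d : ℕ} (h : ∀ j, deg j < d → ∀ m : M, e j • m = 0) :
    lowerTrace M e deg d = ⊥ := by
  refine eq_bot_iff.2 (Submodule.span_le.2 ?_)
  rintro _ ⟨j, hj, m, rfl⟩
  exact h j hj m

theorem mem_lowerTrace_span_idempotent {f : A} (hf : f * f = f) {d : ℕ}
    (x : ↥(Submodule.span A {f})) :
    x ∈ lowerTrace ↥(Submodule.span A {f}) e deg d ↔ (x : A) ∈ lowerTrace A e deg d := by
  refine ⟨map_mem_lowerTrace (Submodule.span A {f}).subtype, fun h => ?_⟩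
  have h2 := map_mem_lowerTrace ((LinearMap.toSpanSingleton A A f).codRestrict
    (Submodule.span A {f}) fun a =>
      Submodule.smul_mem _ a (Submodule.mem_span_singleton_self f)) h
  convert h2
  exact Subtype.ext ((mem_span_idempotent_iff hf).1 x.2).symm

theorem degreeTrace_eq_lowerTrace (he : ∀ i, e i * e i = e i) (i : ι) :
    degreeTrace e deg i = lowerTrace ↥(Submodule.span A {e i}) e deg (deg i) := by
  apply le_antisymm
  · refine iSup₂_le fun j hj => ?_
    rw [traceSubmodule_span_idempotent (he j), Submodule.span_le]
    rintro _ ⟨m, rfl⟩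
    exact smul_mem_lowerTrace hj m
  · refine Submodule.span_le.2 ?_
    rintro _ ⟨j, hj, m, rfl⟩
    refine Submodule.mem_iSup_of_mem j (Submodule.mem_iSup_of_mem hj ?_)
    rw [traceSubmodule_span_idempotent (he j)]
    exact Submodule.subset_span ⟨m, rfl⟩

end Trace

/-! ### Algebras stratified by degree -/

/-- The part of the Reedy condition that makes the algebra quasi-hereditary. With `I d` the ideal
generated by the idempotents of degree less than `d`, modulo `I (deg i)` the corner at `e i` is
spanned by `e i ≠ 0`, the other `e j A e i` with `deg j ≤ deg i` vanish, and, for each `d`, the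
multiplication `⨁ A e l ⊗ e l A → A` over the `l` of degree `d` is injective modulo `I d`. The last
condition is spelled out on elements: in a relation `∑ a x * x ∈ I d` with the `x` linearly
independent modulo `I d`, every coefficient is trivial. -/
structure IsStratified (k : Type u) {A : Type v} [Field k] [Ring A] [Algebra k A] {ι : Type w}
    [Fintype ι] (e : ι → A) (deg : ι → ℕ) : Prop where
  idem : CompleteOrthogonalIdempotents e
  notMem : ∀ i, e i ∉ lowerTrace A e deg (deg i)
  diag : ∀ i a, ∃ c : k, e i * a * e i - c • e i ∈ lowerTrace A e deg (deg i)
  offDiag : ∀ i j a, j ≠ i → deg j ≤ deg i → e j * a * e i ∈ lowerTrace A e deg (deg i)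
  indep : ∀ (d : ℕ) (s : Finset A) (l : A → ι) (a : A → A),
    (∀ x ∈ s, deg (l x) = d ∧ e (l x) * x = x) →
    LinearIndepOn k (lowerTrace A e deg d).mkQ (s : Set A) →
    ∑ x ∈ s, a x * x ∈ lowerTrace A e deg d →
    ∀ x ∈ s, a x * e (l x) ∈ lowerTrace A e deg d

section Generators

variable {A : Type v} [Ring A] {ι : Type w} (e : ι → A) (deg : ι → ℕ) (i : ι)

/-- The class of `e i`, a generator of `DegreeStandard e deg i`. -/
def standardGen : DegreeStandard e deg i :=
  Submodule.Quotient.mk ⟨e i, Submodule.mem_span_singleton_self (e i)⟩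

/-- The class of `e i`, a generator of `degreeSimple e deg i`. -/
def simpleGen : degreeSimple e deg i :=
  Submodule.Quotient.mk (standardGen e deg i)

theorem span_standardGen : Submodule.span A {standardGen e deg i} = ⊤ := by
  rw [eq_top_iff]
  rintro z -
  obtain ⟨⟨z, hz⟩, rfl⟩ := Submodule.Quotient.mk_surjective _ z
  obtain ⟨a, rfl⟩ := Submodule.mem_span_singleton.1 hz
  exact Submodule.mem_span_singleton.2 ⟨a, rfl⟩

theorem span_simpleGen : Submodule.span A {simpleGen e deg i} = ⊤ := by
  rw [eq_top_iff]
  rintro z -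
  obtain ⟨z, rfl⟩ := Submodule.Quotient.mk_surjective _ z
  obtain ⟨a, rfl⟩ := toSpanSingleton_surjective (span_standardGen e deg i) z
  exact Submodule.mem_span_singleton.2 ⟨a, rfl⟩

variable {e deg i}

theorem smul_standardGen_eq_zero_iff (he : ∀ i, e i * e i = e i) {a : A} :
    a • standardGen e deg i = 0 ↔ a * e i ∈ lowerTrace A e deg (deg i) := by
  rw [standardGen, ← Submodule.Quotient.mk_smul, Submodule.Quotient.mk_eq_zero,
    degreeTrace_eq_lowerTrace he, mem_lowerTrace_span_idempotent (he i)]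
  rfl

theorem smul_simpleGen_eq_zero (he : ∀ i, e i * e i = e i) {a : A}
    (h : a * e i ∈ lowerTrace A e deg (deg i)) : a • simpleGen e deg i = 0 := by
  rw [simpleGen, ← Submodule.Quotient.mk_smul, (smul_standardGen_eq_zero_iff he).2 h,
    Submodule.Quotient.mk_zero]

theorem idem_smul_standardGen (he : ∀ i, e i * e i = e i) :
    e i • standardGen e deg i = standardGen e deg i :=
  congrArg Submodule.Quotient.mk (Subtype.ext (he i))

theorem idem_smul_simpleGen (he : ∀ i, e i * e i = e i) :
    e i • simpleGen e deg i = simpleGen e deg i :=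
  congrArg Submodule.Quotient.mk (idem_smul_standardGen he)

end Generators

namespace IsStratified

variable {k : Type u} {A : Type v} [Field k] [Ring A] [Algebra k A] {ι : Type w} [Fintype ι]
  {e : ι → A} {deg : ι → ℕ} (H : IsStratified k e deg)

include H

theorem idem_mul (i : ι) : e i * e i = e i := H.idem.idem i

theorem standardGen_ne_zero (i : ι) : standardGen e deg i ≠ 0 := by
  intro h
  rw [← one_smul A (standardGen e deg i), smul_standardGen_eq_zero_iff H.idem_mul, one_mul] at h
  exact H.notMem i h

theorem idem_smul_standard (i : ι) (x : DegreeStandard e deg i) :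
    ∃ c : k, e i • x = (c • e i) • standardGen e deg i := by
  obtain ⟨a, rfl⟩ := toSpanSingleton_surjective (span_standardGen e deg i) x
  obtain ⟨c, hc⟩ := H.diag i a
  refine ⟨c, ?_⟩
  rw [LinearMap.toSpanSingleton_apply, smul_smul, ← sub_eq_zero, ← sub_smul,
    smul_standardGen_eq_zero_iff H.idem_mul, sub_mul, smul_mul_assoc, H.idem_mul]
  exact hc

theorem eq_or_lt_of_smul_standard_ne_zero {i j : ι} {x : DegreeStandard e deg i}
    (h : e j • x ≠ 0) : j = i ∨ deg i < deg j := by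
  by_contra! hij
  obtain ⟨a, rfl⟩ := toSpanSingleton_surjective (span_standardGen e deg i) x
  rw [LinearMap.toSpanSingleton_apply, smul_smul, Ne,
    smul_standardGen_eq_zero_iff H.idem_mul] at h
  exact h (H.offDiag i j a hij.1 hij.2)

/-- The submodule of all `x` with `e i A x = 0` contains every proper submodule: an element with
`e i x ≠ 0` generates `DegreeStandard e deg i`, because `e i x` is a multiple of the generator. -/
theorem exists_greatest_proper (i : ι) :
    ∃ N₀ : Submodule A (DegreeStandard e deg i), N₀ ≠ ⊤ ∧ ∀ N, N ≠ ⊤ → N ≤ N₀ := by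
  let N₀ : Submodule A (DegreeStandard e deg i) :=
    { carrier := {x | ∀ a : A, (e i * a) • x = 0}
      add_mem' := fun hx hy a => by rw [smul_add, hx a, hy a, add_zero]
      zero_mem' := fun a => smul_zero _
      smul_mem' := fun b x hx a => by rw [smul_smul, mul_assoc]; exact hx _ }
  refine ⟨N₀, fun h => ?_, fun N hN x hx a => ?_⟩
  · have : standardGen e deg i ∈ N₀ := h ▸ Submodule.mem_top
    have h1 := this 1
    rw [mul_one, idem_smul_standardGen H.idem_mul] at h1
    exact H.standardGen_ne_zero i h1
  · by_contra hne
    obtain ⟨c, hc⟩ := H.idem_smul_standard i (a • x)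
    rw [smul_smul] at hc
    rw [hc] at hne
    have hc0 : c ≠ 0 := by
      rintro rfl
      exact hne (by rw [zero_smul, zero_smul])
    apply hN
    rw [eq_top_iff, ← span_standardGen e deg i, Submodule.span_singleton_le_iff_mem]
    have : standardGen e deg i = (algebraMap k A c⁻¹ * (e i * a)) • x := by
      rw [mul_smul, hc, smul_smul, ← Algebra.smul_def, smul_smul, inv_mul_cancel₀ hc0, one_smul,
        idem_smul_standardGen H.idem_mul]
    rw [this]
    exact N.smul_mem _ hx

theorem existsUnique_isCoatom (i : ι) :
    ∃! N : Submodule A (DegreeStandard e deg i), IsCoatom N := by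
  obtain ⟨N₀, h0, h⟩ := H.exists_greatest_proper i
  refine ⟨N₀, ⟨h0, fun N hN => ?_⟩, fun N hN => ?_⟩
  · by_contra hne
    exact hN.not_ge (h N hne)
  · exact (hN.le_iff_eq h0).1 (h N hN.1) |>.symm

theorem jacobson_eq {i : ι} {N : Submodule A (DegreeStandard e deg i)} (hN : IsCoatom N) :
    Module.jacobson A (DegreeStandard e deg i) = N := by
  have : {m : Submodule A (DegreeStandard e deg i) | IsCoatom m} = {N} :=
    Set.eq_singleton_iff_unique_mem.2
      ⟨hN, fun m hm => (H.existsUnique_isCoatom i).unique hm hN⟩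
  rw [Module.jacobson, this, sInf_singleton]

theorem isSimpleModule (i : ι) : IsSimpleModule A (degreeSimple e deg i) := by
  obtain ⟨N, hN, -⟩ := H.existsUnique_isCoatom i
  refine isSimpleModule_iff_isCoatom.2 ?_
  rwa [H.jacobson_eq hN]

theorem simpleGen_ne_zero (i : ι) : simpleGen e deg i ≠ 0 := by
  intro h
  have := H.isSimpleModule i
  have h2 := span_simpleGen e deg i
  rw [h, Submodule.span_zero_singleton] at h2
  exact bot_ne_top h2

theorem smul_idem_smul_simpleGen {i : ι} {c : k} (h : (c • e i) • simpleGen e deg i = 0) :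
    c = 0 := by
  by_contra hc
  apply H.simpleGen_ne_zero i
  rw [← smul_zero (algebraMap k A c⁻¹), ← h, smul_smul, ← Algebra.smul_def, smul_smul,
    inv_mul_cancel₀ hc, one_smul, idem_smul_simpleGen H.idem_mul]

theorem eq_or_lt_of_smul_simple_ne_zero {i j : ι} {x : degreeSimple e deg i}
    (h : e j • x ≠ 0) : j = i ∨ deg i < deg j := by
  obtain ⟨x, rfl⟩ := Submodule.Quotient.mk_surjective _ x
  refine H.eq_or_lt_of_smul_standard_ne_zero (x := x) fun h0 => h ?_
  rw [← Submodule.Quotient.mk_smul, h0, Submodule.Quotient.mk_zero]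

theorem exists_idem_smul_ne_zero {M : Type*} [AddCommGroup M] [Module A M] {x : M} (hx : x ≠ 0) :
    ∃ j, e j • x ≠ 0 := by
  by_contra! h
  apply hx
  rw [← one_smul A x, ← H.idem.complete, Finset.sum_smul]
  exact Finset.sum_eq_zero fun j _ => h j

theorem isCompleteSimpleFamily : IsCompleteSimpleFamily (degreeSimple e deg) where
  simple := H.isSimpleModule
  unique i j := by
    rintro ⟨φ⟩
    have h1 : e i • φ (simpleGen e deg i) ≠ 0 := by
      rw [← map_smul, idem_smul_simpleGen H.idem_mul]
      exact fun h => H.simpleGen_ne_zero i (φ.map_eq_zero_iff.1 h)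
    have h2 : e j • φ.symm (simpleGen e deg j) ≠ 0 := by
      rw [← map_smul, idem_smul_simpleGen H.idem_mul]
      exact fun h => H.simpleGen_ne_zero j (φ.symm.map_eq_zero_iff.1 h)
    rcases H.eq_or_lt_of_smul_simple_ne_zero h1 with h | h
    · exact h
    · rcases H.eq_or_lt_of_smul_simple_ne_zero h2 with h' | h'
      · exact h'.symm
      · omega
  exhaust M _ _ hM := by
    -- A vertex of least degree at which `M` does not vanish determines `M`.
    have := IsSimpleModule.nontrivial A M
    obtain ⟨x, hx⟩ := exists_ne (0 : M)
    obtain ⟨i, hi, hmin⟩ := (measure deg).wf.has_min {j | ∃ y : M, e j • y ≠ 0}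
      (let ⟨j, hj⟩ := H.exists_idem_smul_ne_zero hx; ⟨j, x, hj⟩)
    obtain ⟨y, hy⟩ := hi
    obtain ⟨φ, hφ⟩ := exists_linearMap_of_annihilator_le (y := e i • y)
      (span_standardGen e deg i) fun a ha => by
        rw [smul_standardGen_eq_zero_iff H.idem_mul] at ha
        have hbot : lowerTrace M e deg (deg i) = ⊥ := lowerTrace_eq_bot fun j hj m => by
          by_contra hne
          exact hmin j ⟨m, hne⟩ hj
        have := smul_mem_lowerTrace_of_mem ha y
        rwa [hbot, Submodule.mem_bot, mul_smul] at this
    have hsurj : Function.Surjective φ := LinearMap.surjective_of_ne_zero fun h0 => by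
      rw [h0] at hφ
      exact hy hφ.symm
    refine ⟨i, ⟨?_⟩⟩
    have hco : IsCoatom (LinearMap.ker φ) := by
      rw [← isSimpleModule_iff_isCoatom]
      exact IsSimpleModule.congr (φ.quotKerEquivOfSurjective hsurj)
    exact ((Submodule.quotEquivOfEq _ _ (H.jacobson_eq hco)).trans
      (φ.quotKerEquivOfSurjective hsurj)).symm

end IsStratified

/-! ### Projective covers of the simple modules -/

/-- An idempotent `f` below `e i` with `A f` a projective cover of the simple module at `i`: it
fixes the generator of the simple module, and every smaller left ideal kills this generator. -/
structure IsPrimitiveAt {A : Type v} [Ring A] {ι : Type w} (e : ι → A) (deg : ι → ℕ) (i : ι)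
    (f : A) : Prop where
  idem : f * f = f
  left : e i * f = f
  right : f * e i = f
  smul_gen : f • simpleGen e deg i = simpleGen e deg i
  minimal : ∀ N ≤ Submodule.span A {f},
    (∃ n ∈ N, n • simpleGen e deg i = simpleGen e deg i) → N = Submodule.span A {f}

theorem IsPrimitiveAt.isProjectiveCover {A : Type v} [Ring A] {ι : Type w} {e : ι → A}
    {deg : ι → ℕ} {i : ι} {f : A} (hf : IsPrimitiveAt e deg i f) :
    IsProjectiveCover ((LinearMap.toSpanSingleton A (degreeSimple e deg i)
      (simpleGen e deg i)).domRestrict (Submodule.span A {f})) where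
  projective := projective_span_idempotent hf.idem
  surjective x := by
    obtain ⟨a, rfl⟩ := toSpanSingleton_surjective (span_simpleGen e deg i) x
    refine ⟨⟨a * f, Submodule.smul_mem _ a (Submodule.mem_span_singleton_self f)⟩, ?_⟩
    rw [LinearMap.domRestrict_apply, LinearMap.toSpanSingleton_apply,
      LinearMap.toSpanSingleton_apply, mul_smul, hf.smul_gen]
  superfluous N hN := by
    have hmem : (⟨f, Submodule.mem_span_singleton_self f⟩ : ↥(Submodule.span A {f})) ∈
        N ⊔ LinearMap.ker ((LinearMap.toSpanSingleton A (degreeSimple e deg i)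
          (simpleGen e deg i)).domRestrict (Submodule.span A {f})) := hN ▸ Submodule.mem_top
    obtain ⟨n, hn, m, hm, hnm⟩ := Submodule.mem_sup.1 hmem
    have hm' : (m : A) • simpleGen e deg i = 0 := hm
    have hnm' : (n : A) + m = f := congrArg Subtype.val hnm
    have := hf.minimal (N.map (Submodule.span A {f}).subtype) (Submodule.map_subtype_le _ _)
      ⟨n, ⟨n, hn, rfl⟩, by rw [← add_zero ((n : A) • _), ← hm', ← add_smul, hnm', hf.smul_gen]⟩
    rw [eq_top_iff]
    intro x _
    have hx : (x : A) ∈ N.map (Submodule.span A {f}).subtype := this.ge x.2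
    obtain ⟨y, hy, hyx⟩ := hx
    rwa [← Subtype.ext (a1 := y) (a2 := x) hyx]

namespace IsStratified

variable {k : Type u} {A : Type v} [Field k] [Ring A] [Algebra k A] {ι : Type w} [Fintype ι]
  {e : ι → A} {deg : ι → ℕ} (H : IsStratified k e deg)

include H

/-- The idempotent is found in a minimal left ideal among those inside `A e i` that do
not kill the generator of the simple module. -/
theorem exists_primitive [IsArtinianRing A] [IsNoetherianRing A] (i : ι) :
    ∃ f : A, IsPrimitiveAt e deg i f := by
  obtain ⟨P, ⟨hPle, u₀, hu₀, hug₀⟩, hmin⟩ := (wellFounded_lt (α := Submodule A A)).has_min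
    {P | P ≤ Submodule.span A {e i} ∧ ∃ u ∈ P, u • simpleGen e deg i = simpleGen e deg i}
    ⟨_, le_rfl, e i, Submodule.mem_span_singleton_self _, idem_smul_simpleGen H.idem_mul⟩
  have hmin' : ∀ N ≤ P, (∃ n ∈ N, n • simpleGen e deg i = simpleGen e deg i) → N = P := by
    intro N hN hn
    by_contra hne
    exact hmin N ⟨hN.trans hPle, hn⟩ (lt_of_le_of_ne hN hne)
  set u := e i * u₀ with hu_def
  have hu : u ∈ P := P.smul_mem (e i) hu₀
  have hug : u • simpleGen e deg i = simpleGen e deg i := by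
    rw [hu_def, mul_smul, hug₀, idem_smul_simpleGen H.idem_mul]
  have heu : e i * u = u := by rw [hu_def, ← mul_assoc, H.idem_mul]
  -- Right multiplication by `u` maps `P` onto `P` by minimality, hence is bijective on `P`.
  let R : P →ₗ[A] P := ((LinearMap.toSpanSingleton A A u).domRestrict P).codRestrict P
    fun x => P.smul_mem (x : A) hu
  have hRsurj : Function.Surjective R := by
    have : (LinearMap.range R).map P.subtype = P := by
      refine hmin' _ (Submodule.map_subtype_le _ _) ⟨u * u, ?_, by rw [mul_smul, hug, hug]⟩
      exact ⟨R ⟨u, hu⟩, ⟨_, rfl⟩, rfl⟩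
    intro y
    have hy : (y : A) ∈ (LinearMap.range R).map P.subtype := this.ge y.2
    obtain ⟨z, ⟨x, rfl⟩, hz⟩ := hy
    exact ⟨x, Subtype.ext hz⟩
  have hRinj : Function.Injective R := IsNoetherian.injective_of_surjective_endomorphism R hRsurj
  obtain ⟨⟨f, hfP⟩, hf⟩ := hRsurj ⟨u, hu⟩
  have hfu : f * u = u := congrArg Subtype.val hf
  have hinj : ∀ x ∈ P, ∀ y ∈ P, x * u = y * u → x = y := fun x hx y hy h =>
    congrArg Subtype.val (@hRinj ⟨x, hx⟩ ⟨y, hy⟩ (Subtype.ext h))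
  have hxf : ∀ x ∈ P, x * f = x := fun x hx =>
    hinj _ (P.smul_mem x hfP) _ hx (by rw [smul_eq_mul, mul_assoc, hfu])
  have hPf : P = Submodule.span A {f} := le_antisymm
    (fun x hx => Submodule.mem_span_singleton.2 ⟨x, hxf x hx⟩)
    ((Submodule.span_singleton_le_iff_mem _ _).2 hfP)
  refine ⟨f, hxf f hfP, hinj _ (P.smul_mem _ hfP) _ hfP (by rw [smul_eq_mul, mul_assoc, hfu, heu]),
    (mem_span_idempotent_iff (H.idem_mul i)).1 (hPle hfP), ?_, hPf ▸ hmin'⟩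
  conv_lhs => rw [← hug]
  rw [smul_smul, hfu, hug]

variable {i : ι} {f : A}

/-- Modulo the lower ideal the idempotents `f` and `e i` agree. -/
theorem idem_sub_primitive_mem (hf : IsPrimitiveAt e deg i f) :
    e i - f ∈ lowerTrace A e deg (deg i) := by
  obtain ⟨c, hc⟩ := H.diag i f
  rw [hf.left, hf.right] at hc
  have hc0 : (f - c • e i) * e i ∈ lowerTrace A e deg (deg i) := mul_mem_lowerTrace_right hc _
  have h0 := smul_simpleGen_eq_zero H.idem_mul hc0
  have h1 : ((1 - c) • e i) • simpleGen e deg i = 0 := by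
    rw [← h0, sub_smul, sub_smul, sub_smul, one_smul, idem_smul_simpleGen H.idem_mul, hf.smul_gen]
  have hc1 : c = 1 := (sub_eq_zero.1 (H.smul_idem_smul_simpleGen h1)).symm
  rw [hc1, one_smul] at hc
  rw [← neg_sub]
  exact neg_mem hc

theorem mul_primitive_mem_iff (hf : IsPrimitiveAt e deg i f) (a : A) :
    a * f ∈ lowerTrace A e deg (deg i) ↔ a * e i ∈ lowerTrace A e deg (deg i) := by
  have h := (lowerTrace A e deg (deg i)).smul_mem a (H.idem_sub_primitive_mem hf)
  rw [smul_eq_mul, mul_sub] at h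
  exact ⟨fun h' => by simpa using add_mem h h', fun h' => by simpa using sub_mem h' h⟩

/-- The idempotent `e j` lies in the ideal generated by the primitive idempotents of degree at most
`deg j`: otherwise `A e j` would have a simple quotient killed by all of them. -/
theorem idem_mem_span_primitive {f : ι → A}
    (hf : ∀ l, IsPrimitiveAt e deg l (f l)) (j : ι) :
    e j ∈ Submodule.span A {x | ∃ l, deg l ≤ deg j ∧ ∃ a, x = f l * a} := by
  set U := Submodule.span A {x | ∃ l, deg l ≤ deg j ∧ ∃ a, x = f l * a} with hU
  by_contra hj
  have hmem := Submodule.mem_span_singleton_self (R := A) (e j)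
  rcases eq_top_or_exists_le_coatom (U.comap (Submodule.span A {e j}).subtype) with h | ⟨W, hW, hUW⟩
  · exact hj (show (⟨e j, hmem⟩ : ↥(Submodule.span A {e j})) ∈
      U.comap (Submodule.span A {e j}).subtype from h ▸ Submodule.mem_top)
  · have hsimple : IsSimpleModule A (↥(Submodule.span A {e j}) ⧸ W) :=
      isSimpleModule_iff_isCoatom.2 hW
    obtain ⟨l, ⟨ψ⟩⟩ := H.isCompleteSimpleFamily.exhaust _ hsimple
    have hg : (Submodule.Quotient.mk ⟨e j, hmem⟩ : ↥(Submodule.span A {e j}) ⧸ W) ≠ 0 := by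
      intro h
      rw [Submodule.Quotient.mk_eq_zero] at h
      refine hW.1 (eq_top_iff.2 ?_)
      rintro ⟨x, hx⟩ -
      obtain ⟨a, rfl⟩ := Submodule.mem_span_singleton.1 hx
      exact W.smul_mem a h
    have hne : e j • ψ (Submodule.Quotient.mk ⟨e j, hmem⟩) ≠ 0 := by
      rw [← map_smul, ← Submodule.Quotient.mk_smul]
      rw [show e j • (⟨e j, hmem⟩ : ↥(Submodule.span A {e j})) = ⟨e j, hmem⟩ from
        Subtype.ext (H.idem_mul j)]
      exact fun h => hg (ψ.map_eq_zero_iff.1 h)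
    have hl : deg l ≤ deg j := by
      rcases H.eq_or_lt_of_smul_simple_ne_zero hne with rfl | h
      · exact le_rfl
      · exact h.le
    obtain ⟨⟨y, hy⟩, hyz⟩ := Submodule.Quotient.mk_surjective _ (ψ.symm (simpleGen e deg l))
    have h0 : f l • (Submodule.Quotient.mk ⟨y, hy⟩ : ↥(Submodule.span A {e j}) ⧸ W) = 0 := by
      rw [← Submodule.Quotient.mk_smul, Submodule.Quotient.mk_eq_zero]
      exact hUW (Submodule.subset_span ⟨l, hl, y, rfl⟩)
    rw [hyz, ← map_smul, (hf l).smul_gen, ψ.symm.map_eq_zero_iff] at h0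
    exact H.simpleGen_ne_zero l h0

/-! ### Filtrations by simple and by standard modules -/

/-- A module of finite length is filtered by the simple modules at the vertices where it does not
vanish. -/
theorem isFilteredBy_simple {M : Type v} [AddCommGroup M] [Module A M] [IsArtinian A M]
    [IsNoetherian A M] {s : Set ι} (hs : ∀ j, (∃ y : M, e j • y ≠ 0) → j ∈ s) :
    IsFilteredBy (A := A) M (fun j => degreeSimple e deg j) s := by
  refine isFilteredBy_of_chain (span_simpleGen e deg) LinearMap.id Function.injective_id ?_
  rw [LinearMap.range_id]
  suffices ∀ N : Submodule A M,
      Relation.ReflTransGen (CyclicStep (simpleGen e deg) s) N ⊤ from this ⊥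
  intro N
  induction N using WellFoundedGT.induction with
  | _ N ih =>
    by_cases htop : N = ⊤
    · rw [htop]
    obtain ⟨N', hcov⟩ := exists_covBy_of_wellFoundedLT (a := N) (by rwa [isMax_iff_eq_top])
    have hsimple := (covBy_iff_quot_is_simple hcov.le).1 hcov
    obtain ⟨j, ⟨ψ⟩⟩ := H.isCompleteSimpleFamily.exhaust _ hsimple
    obtain ⟨⟨x, hx⟩, hxj⟩ := Submodule.Quotient.mk_surjective _ (ψ.symm (simpleGen e deg j))
    have key : ∀ a : A, a • x ∈ N ↔ a • simpleGen e deg j = 0 := fun a => by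
      rw [← ψ.symm.map_eq_zero_iff, map_smul, ← hxj, ← Submodule.Quotient.mk_smul,
        Submodule.Quotient.mk_eq_zero]
      rfl
    have hxN : x ∉ N := fun h => H.simpleGen_ne_zero j (by
      rw [← one_smul A (simpleGen e deg j), ← key, one_smul]; exact h)
    refine .head ⟨j, hs j ⟨x, fun h => ?_⟩, x, ?_, key⟩ (ih N' hcov.lt)
    · have := (key (e j)).1 (h ▸ N.zero_mem)
      rw [idem_smul_simpleGen H.idem_mul] at this
      exact H.simpleGen_ne_zero j this
    · refine ((hcov.eq_or_eq le_sup_left (sup_le hcov.le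
        ((Submodule.span_singleton_le_iff_mem _ _).2 hx))).resolve_left fun h => hxN ?_).symm
      rw [← h]
      exact Submodule.mem_sup_right (Submodule.mem_span_singleton_self x)

end IsStratified

namespace IsStratified

variable {k : Type u} {A : Type v} [Field k] [Ring A] [Algebra k A] {ι : Type w} [Fintype ι]
  {e : ι → A} {deg : ι → ℕ} (H : IsStratified k e deg)

include H

/-- In the left ideal `A f`, the layer between degrees `d` and `d + 1` of the trace filtration is a
direct sum of standard modules of degree `d`. Generators of the summands are homogeneous elements
of `A f` forming a `k`-basis modulo the lower ideal. -/
theorem chain_layer [FiniteDimensional k A] {f : A} (hf : f * f = f) (d : ℕ) {s : Set ι}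
    (hs : ∀ l, deg l = d → l ∈ s) :
    Relation.ReflTransGen (CyclicStep (standardGen e deg) s)
      (lowerTrace A e deg d ⊓ Submodule.span A {f})
      (lowerTrace A e deg (d + 1) ⊓ Submodule.span A {f}) := by
  classical
  rcases isEmpty_or_nonempty ι with hι | ⟨⟨l₀⟩⟩
  · have : Subsingleton A := subsingleton_of_zero_eq_one (by rw [← H.idem.complete]; simp)
    rw [Subsingleton.elim (lowerTrace A e deg d ⊓ Submodule.span A {f})
      (lowerTrace A e deg (d + 1) ⊓ Submodule.span A {f})]
  set I := lowerTrace A e deg d with hI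
  set P := Submodule.span A {f} with hP
  have hfin : Module.Finite k (A ⧸ I) :=
    Module.Finite.of_surjective (I.mkQ.restrictScalars k) I.mkQ_surjective
  obtain ⟨b, hbS, -, hspan, hlin⟩ := exists_linearIndepOn_extension (K := k) (v := I.mkQ)
    (linearIndepOn_empty k I.mkQ) (Set.empty_subset {x | x ∈ P ∧ ∃ l, deg l = d ∧ e l * x = x})
  have hbfin : b.Finite := Set.finite_coe_iff.1 (LinearIndependent.finite hlin)
  lift b to Finset A using hbfin
  have hbP : ∀ x ∈ b, x ∈ P := fun x hx => (hbS hx).1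
  have hl : ∀ x : A, ∃ l, x ∈ b → deg l = d ∧ e l * x = x := fun x => by
    by_cases hx : x ∈ b
    · obtain ⟨l, h⟩ := (hbS hx).2
      exact ⟨l, fun _ => h⟩
    · exact ⟨l₀, fun h => absurd h hx⟩
  choose l hl using hl
  have hIP : ∀ {x}, x ∈ I → x * f ∈ I ⊓ P := fun hx =>
    ⟨mul_mem_lowerTrace_right hx f, P.smul_mem _ (Submodule.mem_span_singleton_self f)⟩
  have hchain : ∀ t ⊆ b, Relation.ReflTransGen (CyclicStep (standardGen e deg) s) (I ⊓ P)
      (I ⊓ P ⊔ Submodule.span A (t : Set A)) := by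
    intro t
    induction t using Finset.induction_on with
    | empty => simp [Relation.ReflTransGen.refl]
    | @insert x t hxt ih =>
      intro htb
      have hxb : x ∈ b := htb (Finset.mem_insert_self x t)
      refine (ih ((Finset.subset_insert x t).trans htb)).tail
        ⟨l x, hs _ (hl x hxb).1, x, ?_, fun a => ?_⟩
      · rw [Finset.coe_insert, Submodule.span_insert, sup_comm (Submodule.span A {x}), sup_assoc]
      rw [smul_standardGen_eq_zero_iff H.idem_mul, (hl x hxb).1]
      constructor
      · intro h
        obtain ⟨w, hw, z, hz, hwz⟩ := Submodule.mem_sup.1 h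
        obtain ⟨c, -, rfl⟩ := Submodule.mem_span_finset.1 hz
        have := H.indep d (insert x t) l (fun y => if y = x then a else - c y)
          (fun y hy => hl y (htb hy)) (hlin.mono (Finset.coe_subset.2 htb)) ?_ x
          (Finset.mem_insert_self x t)
        · simpa using this
        · rw [Finset.sum_insert hxt, if_pos rfl, Finset.sum_congr rfl
            (g := fun y => - (c y • y)) fun y hy => by
              rw [if_neg (ne_of_mem_of_not_mem hy hxt), neg_mul, smul_eq_mul],
            Finset.sum_neg_distrib, ← smul_eq_mul a x, ← hwz, add_neg_cancel_right]
          exact hw.1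
      · intro h
        refine Submodule.mem_sup_left ⟨?_, P.smul_mem _ (hbP x hxb)⟩
        have := mul_mem_lowerTrace_right h x
        rwa [mul_assoc, (hl x hxb).2] at this
  convert hchain b subset_rfl using 1
  apply le_antisymm
  · rintro y ⟨hy, hyP⟩
    rw [← (mem_span_idempotent_iff hf).1 hyP]
    have : lowerTrace A e deg (d + 1) ≤ (I ⊓ P ⊔ Submodule.span A (b : Set A)).comap
        (LinearMap.toSpanSingleton A A f) := by
      refine Submodule.span_le.2 ?_
      rintro _ ⟨j, hj, m, rfl⟩
      change e j * m * f ∈ I ⊓ P ⊔ Submodule.span A (b : Set A)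
      rcases Nat.lt_succ_iff_lt_or_eq.1 hj with hj | hj
      · exact Submodule.mem_sup_left (hIP (mul_mem_lowerTrace hj m))
      have hP' : e j * m * f ∈ P := P.smul_mem _ (Submodule.mem_span_singleton_self f)
      have hmem := hspan ⟨e j * m * f, ⟨hP', j, hj, by
        rw [← mul_assoc, ← mul_assoc, H.idem_mul]⟩, rfl⟩
      have hmap : Submodule.span k (I.mkQ '' (b : Set A)) =
          (Submodule.span k (b : Set A)).map (I.mkQ.restrictScalars k) :=
        (Submodule.map_span (I.mkQ.restrictScalars k) (b : Set A)).symm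
      rw [SetLike.mem_coe, hmap] at hmem
      obtain ⟨v, hv, hvm⟩ := hmem
      have hv' : v ∈ Submodule.span A (b : Set A) :=
        Submodule.span_le_restrictScalars k A (b : Set A) hv
      have hvI : e j * m * f - v ∈ I := (Submodule.Quotient.eq I).1 hvm.symm
      rw [← sub_add_cancel (e j * m * f) v]
      exact Submodule.add_mem_sup ⟨hvI, P.sub_mem hP' (Submodule.span_le.2 hbP hv')⟩ hv'
    exact this hy
  · refine sup_le (inf_le_inf_right P (lowerTrace_mono d.le_succ)) (Submodule.span_le.2 ?_)
    intro x hx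
    refine ⟨?_, hbP x hx⟩
    have := mul_mem_lowerTrace (e := e) (deg := deg) (d := d + 1) (j := l x)
      (by rw [(hl x hx).1]; exact d.lt_succ_self) x
    rwa [(hl x hx).2] at this

theorem chain_standard [FiniteDimensional k A] {f : A} (hf : f * f = f) (n : ℕ) :
    Relation.ReflTransGen (CyclicStep (standardGen e deg) {l | deg l < n}) ⊥
      (lowerTrace A e deg n ⊓ Submodule.span A {f}) := by
  induction n with
  | zero => rw [lowerTrace_zero, bot_inf_eq]
  | succ d ih =>
    have hmono : ∀ N N' : Submodule A A, CyclicStep (standardGen e deg) {l | deg l < d} N N' →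
        CyclicStep (standardGen e deg) {l | deg l < d + 1} N N' := fun N N' h =>
      h.mono fun l hl => Nat.lt_succ_of_lt hl
    exact .trans (Relation.ReflTransGen.mono hmono _ _ ih)
      (H.chain_layer hf d fun l hl => hl.trans_lt d.lt_succ_self)

/-! ### Quasi-heredity -/

/-- The trace in `A f i` of the projective covers of the simple modules at the vertices `j ⋬ i` is
that of the `A e j` with `deg j < deg i`. -/
theorem standardKernel_eq {f : ι → A} (hf : ∀ l, IsPrimitiveAt e deg l (f l)) (i : ι) :
    standardKernel (weightOrder deg) (fun l => ModuleCat.of A ↥(Submodule.span A {f l})) i =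
      lowerTrace ↥(Submodule.span A {f i}) e deg (deg i) := by
  have htr : ∀ j, traceSubmodule A ↥(Submodule.span A {f j}) ↥(Submodule.span A {f i}) =
      Submodule.span A (Set.range fun m : ↥(Submodule.span A {f i}) => f j • m) := fun j =>
    traceSubmodule_span_idempotent (hf j).idem
  apply le_antisymm
  · refine iSup₂_le fun j hj => ?_
    refine (htr j).le.trans (Submodule.span_le.2 ?_)
    rintro _ ⟨⟨m, hm⟩, rfl⟩
    rw [SetLike.mem_coe, mem_lowerTrace_span_idempotent (hf i).idem]
    have hji : j ≠ i := fun h => hj (Or.inl h)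
    have hdeg : deg j ≤ deg i := not_lt.1 fun h => hj (Or.inr h)
    have := (lowerTrace A e deg (deg i)).smul_mem (f j) (H.offDiag i j m hji hdeg)
    change f j * m ∈ _
    have hmi : m * e i = m := by
      rw [← (mem_span_idempotent_iff (hf i).idem).1 hm, mul_assoc, (hf i).right]
    rwa [smul_eq_mul, mul_assoc, hmi, ← mul_assoc, (hf j).right] at this
  · refine Submodule.span_le.2 ?_
    rintro _ ⟨j, hj, m, rfl⟩
    have hle : Submodule.span A {x | ∃ l, deg l ≤ deg j ∧ ∃ a, x = f l * a} ≤
        (standardKernel (weightOrder deg) (fun l => ModuleCat.of A ↥(Submodule.span A {f l}))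
          i).comap (LinearMap.toSpanSingleton A ↥(Submodule.span A {f i}) m) := by
      refine Submodule.span_le.2 ?_
      rintro _ ⟨l, hl, a, rfl⟩
      have hli : ¬ (weightOrder deg).le l i := by
        rintro (rfl | h) <;> omega
      refine Submodule.mem_iSup_of_mem l (Submodule.mem_iSup_of_mem hli ((htr l).ge ?_))
      rw [LinearMap.toSpanSingleton_apply, mul_smul]
      exact Submodule.subset_span ⟨a • m, rfl⟩
    exact hle (H.idem_mem_span_primitive hf j)

/-- A stratified algebra is quasi-hereditary, and its standard modules are the quotients of the
`A e i` by the traces from lower degrees. -/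
theorem exists_isQuasiHereditaryWith [FiniteDimensional k A] :
    ∃ (P : ι → ModuleCat.{v} A) (p : ∀ i, P i →ₗ[A] degreeSimple e deg i),
      IsQuasiHereditaryWith (weightOrder deg) (degreeSimple e deg) P p ∧
      ∀ i, Nonempty (Standard (weightOrder deg) P i ≃ₗ[A] DegreeStandard e deg i) := by
  have : IsArtinianRing A := IsArtinianRing.of_finite k A
  have : IsNoetherianRing A := IsNoetherianRing.of_finite k A
  choose f hf using fun i => H.exists_primitive i
  let P : ι → ModuleCat.{v} A := fun l => ModuleCat.of A ↥(Submodule.span A {f l})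
  let p : ∀ i, P i →ₗ[A] degreeSimple e deg i := fun i =>
    (LinearMap.toSpanSingleton A (degreeSimple e deg i)
      (simpleGen e deg i)).domRestrict (Submodule.span A {f i})
  have hker : ∀ i, standardKernel (weightOrder deg) P i =
      lowerTrace ↥(Submodule.span A {f i}) e deg (deg i) := H.standardKernel_eq hf
  have hmem : ∀ i (x : P i), x ∈ standardKernel (weightOrder deg) P i ↔
      (show ↥(Submodule.span A {f i}) from x : A) ∈ lowerTrace A e deg (deg i) := fun i x => by
    rw [hker]
    exact mem_lowerTrace_span_idempotent (hf i).idem _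
  let γ : ∀ i, Standard (weightOrder deg) P i := fun i =>
    Submodule.Quotient.mk (⟨f i, Submodule.mem_span_singleton_self (f i)⟩ :
      ↥(Submodule.span A {f i}))
  have hγ : ∀ i, Submodule.span A {γ i} = ⊤ := fun i => by
    rw [eq_top_iff]
    rintro z -
    obtain ⟨⟨z, hz⟩, rfl⟩ := Submodule.Quotient.mk_surjective _ z
    obtain ⟨a, rfl⟩ := Submodule.mem_span_singleton.1 hz
    exact Submodule.mem_span_singleton.2 ⟨a, rfl⟩
  have hann : ∀ i (a : A), a • γ i = 0 ↔ a • standardGen e deg i = 0 := fun i a => by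
    rw [smul_standardGen_eq_zero_iff H.idem_mul, ← H.mul_primitive_mem_iff (hf i),
      ← Submodule.Quotient.mk_smul, Submodule.Quotient.mk_eq_zero, hmem]
    rfl
  refine ⟨P, p, ⟨H.isCompleteSimpleFamily, fun i => (hf i).isProjectiveCover, fun i => ?_,
    fun i => ?_⟩, fun i => ?_⟩
  · have hle : standardKernel (weightOrder deg) P i ≤ LinearMap.ker (p i) := fun x hx =>
      smul_simpleGen_eq_zero H.idem_mul (mul_mem_lowerTrace_right ((hmem i x).1 hx) (e i))
    refine ⟨(standardKernel (weightOrder deg) P i).liftQ (p i) hle, Submodule.liftQ_mkQ _ _ _, ?_⟩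
    refine H.isFilteredBy_simple fun j => ?_
    rintro ⟨⟨z, hz⟩, hne⟩
    have hne' : e j • z ≠ 0 := fun h => hne (Subtype.ext h)
    obtain ⟨⟨x, hx⟩, rfl⟩ := Submodule.Quotient.mk_surjective _ z
    have hxe : x * e i = x := by
      rw [← (mem_span_idempotent_iff (hf i).idem).1 hx, mul_assoc, (hf i).right]
    have hxg : x • simpleGen e deg i = 0 := hz
    have hjx : e j * x ∉ lowerTrace A e deg (deg i) := fun h => hne' <| by
      rw [← Submodule.Quotient.mk_smul, Submodule.Quotient.mk_eq_zero, hmem]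
      exact h
    change deg i < deg j
    by_contra! hji
    by_cases hij : j = i
    · subst hij
      obtain ⟨c, hc⟩ := H.diag j x
      rw [mul_assoc, hxe] at hc
      have h0 := smul_simpleGen_eq_zero H.idem_mul (mul_mem_lowerTrace_right hc (e j))
      rw [sub_smul, mul_smul, hxg, smul_zero, zero_sub, neg_eq_zero] at h0
      rw [H.smul_idem_smul_simpleGen h0, zero_smul, sub_zero] at hc
      exact hjx hc
    · have := H.offDiag i j x hij hji
      rw [mul_assoc, hxe] at this
      exact hjx this
  · refine isFilteredBy_of_chain (M := A) (g := γ) hγ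
      ((Submodule.span A {f i}).subtype ∘ₗ (standardKernel (weightOrder deg) P i).subtype)
      (Subtype.val_injective.comp Subtype.val_injective) ?_
    have hstep : ∀ N N' : Submodule A A, CyclicStep (standardGen e deg) {j | deg j < deg i} N N' →
        CyclicStep γ {j | deg j < deg i} N N' := fun N N' ⟨j, hj, x, h1, h2⟩ =>
      ⟨j, hj, x, h1, fun a => (h2 a).trans (hann j a).symm⟩
    have hrange : LinearMap.range ((Submodule.span A {f i}).subtype ∘ₗ
        (standardKernel (weightOrder deg) P i).subtype) =
        lowerTrace A e deg (deg i) ⊓ Submodule.span A {f i} := by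
      ext x
      constructor
      · rintro ⟨y, rfl⟩
        exact ⟨(hmem i y.1).1 y.2, y.1.2⟩
      · rintro ⟨hx, hxP⟩
        exact ⟨⟨⟨x, hxP⟩, (hmem i ⟨x, hxP⟩).2 hx⟩, rfl⟩
    rw [hrange]
    exact Relation.ReflTransGen.mono hstep _ _ (H.chain_standard (hf i).idem (deg i))
  · obtain ⟨φ, -⟩ := exists_linearEquiv_of_annihilator_eq (hγ i) (span_standardGen e deg i)
      (hann i)
    exact ⟨φ⟩

end IsStratified

/-! ### Triangular bases -/

/-- A family `t`, with `t b ∈ A e (l b)`, that exhibits `A` as the direct sum of the right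
`B`-modules `t b • e (l b) B`, where `B` is directed downwards and `t` upwards with respect to
`deg`. For a Reedy algebra, `B = A⁻` and `t` consists of `k`-bases of the spaces `A⁺ e l`. -/
structure IsTriangularBasis {k : Type u} {A : Type v} [Field k] [Ring A] [Algebra k A]
    {ι : Type w} [Fintype ι] (e : ι → A) (deg : ι → ℕ) (B : Subalgebra k A) {β : Type*} [Fintype β]
    (l : β → ι) (t : β → A) : Prop where
  idem : CompleteOrthogonalIdempotents e
  ne_zero : ∀ i, e i ≠ 0
  mem : ∀ i, e i ∈ B
  minus_diag : ∀ i, ∀ x ∈ B, ∃ c : k, e i * x * e i = c • e i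
  minus_deg : ∀ i j, ∀ x ∈ B, j ≠ i → deg i ≤ deg j → e j * x * e i = 0
  mul_idem : ∀ b, t b * e (l b) = t b
  plus_diag : ∀ b, ∃ c : k, e (l b) * t b = c • e (l b)
  plus_deg : ∀ j b, j ≠ l b → deg j ≤ deg (l b) → e j * t b = 0
  idem_eq_sum : ∀ i, ∃ α : β → k, (∀ b, l b ≠ i → α b = 0) ∧ ∑ b, α b • t b = e i
  exists_coord : ∀ a, ∃ c : β → B, (∀ b, e (l b) * (c b : A) = c b) ∧ ∑ b, t b * (c b : A) = a
  coord_unique : ∀ c : β → B, (∀ b, e (l b) * (c b : A) = c b) →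
    ∑ b, t b * (c b : A) = 0 → ∀ b, c b = 0

namespace IsTriangularBasis

variable {k : Type u} {A : Type v} [Field k] [Ring A] [Algebra k A] {ι : Type w} [Fintype ι]
  {e : ι → A} {deg : ι → ℕ} {B : Subalgebra k A} {β : Type*} [Fintype β] {l : β → ι} {t : β → A}
  (T : IsTriangularBasis e deg B l t)

include T

theorem idem_mul (i : ι) : e i * e i = e i := T.idem.idem i

theorem eq_of_sum_eq {c c' : β → B} (hc : ∀ b, e (l b) * (c b : A) = c b)
    (hc' : ∀ b, e (l b) * (c' b : A) = c' b)
    (h : ∑ b, t b * (c b : A) = ∑ b, t b * (c' b : A)) : c = c' := by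
  funext b
  refine sub_eq_zero.1 (T.coord_unique (fun b => c b - c' b) (fun b => ?_) ?_ b)
  · rw [AddSubgroupClass.coe_sub, mul_sub, hc, hc']
  · simp only [AddSubgroupClass.coe_sub, mul_sub, Finset.sum_sub_distrib, h, sub_self]

/-- The coordinates of an element of `A`, with `coord b` taking values in `e (l b) B`. -/
noncomputable def coord (b : β) : A →ₗ[k] B where
  toFun a := (T.exists_coord a).choose b
  map_add' x y := by
    have hx := (T.exists_coord x).choose_spec
    have hy := (T.exists_coord y).choose_spec
    have hxy := (T.exists_coord (x + y)).choose_spec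
    refine congrFun (T.eq_of_sum_eq (c' := (T.exists_coord x).choose + (T.exists_coord y).choose)
      hxy.1 (fun b => ?_) ?_) b
    · simp only [Pi.add_apply, AddMemClass.coe_add, mul_add, hx.1, hy.1]
    · simp only [Pi.add_apply, AddMemClass.coe_add, mul_add, Finset.sum_add_distrib, hx.2, hy.2,
        hxy.2]
  map_smul' r x := by
    have hx := (T.exists_coord x).choose_spec
    have hrx := (T.exists_coord (r • x)).choose_spec
    refine congrFun (T.eq_of_sum_eq (c' := r • (T.exists_coord x).choose)
      hrx.1 (fun b => ?_) ?_) b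
    · simp only [Pi.smul_apply, SetLike.val_smul, mul_smul_comm, hx.1]
    · simp only [Pi.smul_apply, SetLike.val_smul, mul_smul_comm, ← Finset.smul_sum, hx.2, hrx.2]

theorem idem_mul_coord (b : β) (a : A) : e (l b) * (T.coord b a : A) = T.coord b a :=
  (T.exists_coord a).choose_spec.1 b

theorem sum_coord (a : A) : ∑ b, t b * (T.coord b a : A) = a :=
  (T.exists_coord a).choose_spec.2

theorem coord_sum {c : β → B} (hc : ∀ b, e (l b) * (c b : A) = c b) (b : β) :
    T.coord b (∑ b, t b * (c b : A)) = c b :=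
  congrFun (T.eq_of_sum_eq (c := fun b => T.coord b (∑ b, t b * (c b : A)))
    (fun b => T.idem_mul_coord b _) hc (T.sum_coord _)) b

theorem coord_mul (b : β) (a : A) (y : B) : T.coord b (a * y) = T.coord b a * y := by
  have := T.coord_sum (c := fun b => T.coord b a * y)
    (fun b => by rw [MulMemClass.coe_mul, ← mul_assoc, T.idem_mul_coord]) b
  simp only [MulMemClass.coe_mul, ← mul_assoc, ← Finset.sum_mul, T.sum_coord] at this
  exact this

theorem mul_mem_lowerTrace_of_deg_lt {d : ℕ} {b : β} (h : deg (l b) < d) (x y : A) :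
    x * t b * y ∈ lowerTrace A e deg d := by
  rw [← T.mul_idem b, mul_assoc, mul_assoc, ← mul_assoc x]
  exact (lowerTrace A e deg d).smul_mem (x * t b) (mul_mem_lowerTrace h y)

theorem coord_eq_zero_of_mul_idem {y : A} {i : ι} (hy : y * e i = y) {b : β}
    (hb : deg i < deg (l b)) : T.coord b y = 0 := by
  have h := T.coord_mul b y ⟨e i, T.mem i⟩
  rw [hy] at h
  rw [h]
  apply Subtype.ext
  rw [MulMemClass.coe_mul, ← T.idem_mul_coord]
  exact T.minus_deg i (l b) _ (T.coord b y).2 (fun h => by rw [h] at hb; exact lt_irrefl _ hb) hb.le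

/-- The ideal generated by the idempotents of degree less than `d` is spanned by the parts
`t b • e (l b) B` of the decomposition with `deg (l b) < d`. -/
theorem mem_lowerTrace_iff {d : ℕ} {a : A} :
    a ∈ lowerTrace A e deg d ↔ ∀ b, d ≤ deg (l b) → T.coord b a = 0 := by
  constructor
  · have hmul : ∀ (x : A) (c : β → B),
        (∀ b, x * t b ≠ 0 → deg (l b) < d ∨ (c b : A) = 0) →
        ∀ b, d ≤ deg (l b) → T.coord b (x * ∑ b', t b' * (c b' : A)) = 0 := by
      intro x c hc b hb
      rw [Finset.mul_sum, map_sum]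
      refine Finset.sum_eq_zero fun b' _ => ?_
      rw [← mul_assoc]
      by_cases hxb : x * t b' = 0
      · rw [hxb, zero_mul, map_zero]
      · rcases hc b' hxb with h | h
        · rw [T.coord_mul, T.coord_eq_zero_of_mul_idem (i := l b') (by rw [mul_assoc, T.mul_idem])
            (h.trans_le hb), zero_mul]
        · rw [h, mul_zero, map_zero]
    intro ha
    induction ha using Submodule.span_induction with
    | mem x hx =>
      obtain ⟨j, hj, m, rfl⟩ := hx
      have := hmul (e j) (fun b => T.coord b m) fun b hb => Or.inl ?_
      · rwa [T.sum_coord] at this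
      · by_contra! hd
        refine hb (T.plus_deg j b ?_ (hj.le.trans hd))
        rintro rfl
        omega
    | zero => exact fun _ _ => map_zero _
    | add x y _ _ hx hy => exact fun b hb => by rw [map_add, hx b hb, hy b hb, add_zero]
    | smul a x _ hx =>
      have := hmul a (fun b => T.coord b x) fun b _ => ?_
      · rwa [T.sum_coord] at this
      · by_cases hd : d ≤ deg (l b)
        · exact Or.inr (by rw [hx b hd]; rfl)
        · exact Or.inl (not_le.1 hd)
  · intro h
    rw [← T.sum_coord a]
    refine Submodule.sum_mem _ fun b _ => ?_
    by_cases hb : d ≤ deg (l b)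
    · rw [h b hb, ZeroMemClass.coe_zero, mul_zero]
      exact zero_mem _
    · rw [← one_mul (t b)]
      exact T.mul_mem_lowerTrace_of_deg_lt (not_le.1 hb) _ _

/-- Modulo the lower ideal `A e i` is spanned over `k` by the `t b` with `l b = i`. -/
theorem exists_mul_idem_sub_sum_mem (a : A) (i : ι) :
    ∃ α : β → k, (∀ b, l b ≠ i → α b = 0) ∧
      a * e i - ∑ b, α b • t b ∈ lowerTrace A e deg (deg i) := by
  have h : ∀ b, ∃ α : k, (l b ≠ i → α = 0) ∧
      t b * (T.coord b a : A) * e i - α • t b ∈ lowerTrace A e deg (deg i) := by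
    intro b
    by_cases hb : l b = i
    · obtain ⟨c, hc⟩ := T.minus_diag i _ (T.coord b a).2
      refine ⟨c, fun h => absurd hb h, ?_⟩
      have : t b * (T.coord b a : A) * e i = c • t b := by
        rw [mul_assoc, ← T.idem_mul_coord, hb, hc, mul_smul_comm, ← hb, T.mul_idem]
      rw [this, sub_self]
      exact zero_mem _
    · refine ⟨0, fun _ => rfl, ?_⟩
      rw [zero_smul, sub_zero]
      rcases lt_or_ge (deg (l b)) (deg i) with hd | hd
      · rw [mul_assoc, ← one_mul (t b)]
        exact T.mul_mem_lowerTrace_of_deg_lt hd _ _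
      · rw [mul_assoc, ← T.idem_mul_coord, T.minus_deg i (l b) _ (T.coord b a).2 hb hd, mul_zero]
        exact zero_mem _
  choose α hα hmem using h
  refine ⟨α, hα, ?_⟩
  conv => enter [2, 1, 1]; rw [← T.sum_coord a]
  rw [Finset.sum_mul, ← Finset.sum_sub_distrib]
  exact Submodule.sum_mem _ fun b _ => hmem b

/-- Modulo the lower ideal `e i A` agrees with `e i B`. -/
theorem exists_idem_mul_sub_mem (x : A) (i : ι) :
    ∃ y : B, e i * (y : A) = y ∧ e i * x - y ∈ lowerTrace A e deg (deg i) := by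
  have h : ∀ b, ∃ y : B, e i * (y : A) = y ∧
      e i * (t b * (T.coord b x : A)) - y ∈ lowerTrace A e deg (deg i) := by
    intro b
    by_cases hb : l b = i
    · obtain ⟨c, hc⟩ := T.plus_diag b
      refine ⟨c • T.coord b x, ?_, ?_⟩
      · rw [SetLike.val_smul, mul_smul_comm, ← hb, T.idem_mul_coord]
      · rw [← mul_assoc, ← hb, hc, smul_mul_assoc, T.idem_mul_coord, SetLike.val_smul, sub_self]
        exact zero_mem _
    · refine ⟨0, by simp, ?_⟩
      rw [ZeroMemClass.coe_zero, sub_zero, ← mul_assoc]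
      rcases lt_or_ge (deg (l b)) (deg i) with hd | hd
      · exact T.mul_mem_lowerTrace_of_deg_lt hd _ _
      · rw [T.plus_deg i b (Ne.symm hb) hd, zero_mul]
        exact zero_mem _
  choose y hy hmem using h
  refine ⟨∑ b, y b, ?_, ?_⟩
  · rw [AddSubmonoidClass.coe_finsetSum, Finset.mul_sum]
    exact Finset.sum_congr rfl fun b _ => hy b
  · conv => enter [2, 1, 2]; rw [← T.sum_coord x]
    rw [AddSubmonoidClass.coe_finsetSum, Finset.mul_sum, ← Finset.sum_sub_distrib]
    exact Submodule.sum_mem _ fun b _ => hmem b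

theorem idem_notMem (i : ι) : e i ∉ lowerTrace A e deg (deg i) := by
  intro h
  obtain ⟨α, hα, hsum⟩ := T.idem_eq_sum i
  have hcoord := T.coord_sum (c := fun b => α b • ⟨e (l b), T.mem (l b)⟩)
    fun b => by rw [SetLike.val_smul, mul_smul_comm, T.idem_mul]
  simp only [SetLike.val_smul, mul_smul_comm, T.mul_idem, hsum] at hcoord
  refine T.ne_zero i (hsum.symm.trans (Finset.sum_eq_zero fun b _ => ?_))
  by_cases hb : l b = i
  · have h0 := T.mem_lowerTrace_iff.1 h b (by rw [hb])
    rw [hcoord] at h0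
    have h1 : α b • e (l b) = 0 := congrArg Subtype.val h0
    rw [← T.mul_idem b, ← mul_smul_comm, h1, mul_zero]
  · rw [hα b hb, zero_smul]

theorem isStratified : IsStratified k e deg where
  idem := T.idem
  notMem := T.idem_notMem
  diag i a := by
    obtain ⟨y, hy, hmem⟩ := T.exists_idem_mul_sub_mem a i
    obtain ⟨c, hc⟩ := T.minus_diag i y y.2
    refine ⟨c, ?_⟩
    rw [← hc, hy, ← sub_mul]
    exact mul_mem_lowerTrace_right hmem _
  offDiag i j a hji hdeg := by
    rcases hdeg.lt_or_eq with h | h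
    · rw [mul_assoc]
      exact mul_mem_lowerTrace h _
    · obtain ⟨y, hy, hmem⟩ := T.exists_idem_mul_sub_mem a j
      have := mul_mem_lowerTrace_right hmem (e i)
      rwa [sub_mul, ← hy, T.minus_deg i j y y.2 hji h.ge, sub_zero, h] at this
  indep d s li a hs hlin hsum x₀ hx₀ := by
    -- Replace the coefficients by combinations of the `t b` and the `x` by elements of `B`.
    choose α hα hαmem using fun x => T.exists_mul_idem_sub_sum_mem (a x) (li x)
    choose y hy hymem using fun x => T.exists_idem_mul_sub_mem x (li x)
    set c : β → B := fun b => ∑ x ∈ s, α x b • y x with hc_def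
    have hc : ∀ b, e (l b) * (c b : A) = c b := fun b => by
      simp only [hc_def, AddSubmonoidClass.coe_finsetSum, Finset.mul_sum, SetLike.val_smul,
        mul_smul_comm]
      refine Finset.sum_congr rfl fun x _ => ?_
      by_cases hb : l b = li x
      · rw [hb, hy]
      · rw [hα x b hb, zero_smul, zero_smul]
    have hcsum : ∑ b, t b * (c b : A) = ∑ x ∈ s, (∑ b, α x b • t b) * (y x : A) := by
      simp only [hc_def, AddSubmonoidClass.coe_finsetSum, Finset.mul_sum, SetLike.val_smul,
        Finset.sum_mul, mul_smul_comm, smul_mul_assoc]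
      exact Finset.sum_comm
    have hdiff : ∀ x ∈ s, (lowerTrace A e deg d).mkQ ((∑ b, α x b • t b) * (y x : A)) =
        (lowerTrace A e deg d).mkQ (a x * x) := by
      intro x hx
      obtain ⟨hd, hxl⟩ := hs x hx
      have h1 := (lowerTrace A e deg d).smul_mem (a x * e (li x)) (hd ▸ hymem x)
      have h2 := mul_mem_lowerTrace_right (hd ▸ hαmem x) (y x : A)
      have h3 := add_mem h1 h2
      symm
      rw [← sub_eq_zero, ← map_sub, Submodule.mkQ_apply, Submodule.Quotient.mk_eq_zero]
      convert h3 using 1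
      rw [smul_eq_mul, hxl, mul_sub, sub_mul, mul_assoc (a x) _ x, hxl]
      abel
    have hcmem : ∑ b, t b * (c b : A) ∈ lowerTrace A e deg d := by
      rw [← Submodule.Quotient.mk_eq_zero, ← Submodule.mkQ_apply, hcsum, map_sum,
        Finset.sum_congr rfl hdiff, ← map_sum, Submodule.mkQ_apply, Submodule.Quotient.mk_eq_zero]
      exact hsum
    have hα0 : ∀ b, α x₀ b = 0 := by
      intro b
      by_cases hb : l b = li x₀
      · have h0 := T.mem_lowerTrace_iff.1 hcmem b (by rw [hb, (hs x₀ hx₀).1])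
        rw [T.coord_sum hc] at h0
        have h1 : ∑ x ∈ s, α x b • (y x : A) = 0 := by
          simpa [hc_def, AddSubmonoidClass.coe_finsetSum] using congrArg Subtype.val h0
        have h2 : ∑ x ∈ s, α x b • (lowerTrace A e deg d).mkQ x = 0 := by
          have h3 := congrArg ((lowerTrace A e deg d).mkQ.restrictScalars k) h1
          rw [map_sum, map_zero] at h3
          rw [← h3]
          refine Finset.sum_congr rfl fun x hx => ?_
          rw [map_smul]
          congr 1
          obtain ⟨hd, hxl⟩ := hs x hx
          have h4 := hymem x
          rw [hd, hxl] at h4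
          exact (Submodule.Quotient.eq _).2 h4
        exact linearIndepOn_finset_iff.1 hlin (fun x => α x b) h2 x₀ hx₀
      · exact hα x₀ b hb
    have := hαmem x₀
    simpa [hα0, (hs x₀ hx₀).1] using this

/-- The idempotents of `A` as elements of `B`. -/
def restrictIdem : ι → B := fun i => ⟨e i, T.mem i⟩

/-- The idempotents of `B` form a triangular basis of `B` over itself. -/
theorem restrict :
    IsTriangularBasis T.restrictIdem deg (⊤ : Subalgebra k B) id T.restrictIdem where
  idem :=
    { idem i := Subtype.ext (T.idem.idem i)
      ortho i j h := Subtype.ext (T.idem.ortho h)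
      complete := Subtype.ext (by simpa [restrictIdem] using T.idem.complete) }
  ne_zero i h := T.ne_zero i (congrArg Subtype.val h)
  mem _ := trivial
  minus_diag i x _ := by
    obtain ⟨c, hc⟩ := T.minus_diag i x x.2
    exact ⟨c, Subtype.ext hc⟩
  minus_deg i j x _ h h' := Subtype.ext (T.minus_deg i j x x.2 h h')
  mul_idem i := Subtype.ext (T.idem_mul i)
  plus_diag i := ⟨1, Subtype.ext (by simp [restrictIdem, T.idem_mul])⟩
  plus_deg i j h _ := Subtype.ext (T.idem.ortho h)
  idem_eq_sum i := by
    classical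
    exact ⟨fun j => if j = i then 1 else 0, fun j hj => if_neg hj, by simp⟩
  exists_coord a := by
    refine ⟨fun i => ⟨T.restrictIdem i * a, trivial⟩, fun i => Subtype.ext ?_, Subtype.ext ?_⟩
    · simp [restrictIdem, ← mul_assoc, T.idem_mul]
    · simp [restrictIdem, ← mul_assoc, T.idem_mul, ← Finset.sum_mul, T.idem.complete]
  coord_unique c hc hsum i := by
    apply Subtype.ext
    have h : ∀ j, T.restrictIdem j * (c j : B) = c j := hc
    have h2 : T.restrictIdem i * ∑ j, T.restrictIdem j * (c j : B) = 0 := by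
      rw [hsum, mul_zero]
    rw [Finset.mul_sum, Finset.sum_eq_single i] at h2
    · rwa [h, h] at h2
    · intro j _ hj
      rw [← mul_assoc]
      have : T.restrictIdem i * T.restrictIdem j = 0 := Subtype.ext (T.idem.ortho hj.symm)
      rw [this, zero_mul]
    · simp

end IsTriangularBasis

/-! ### Induction from a subalgebra with a triangular basis -/

section Induced

variable {k : Type u} {A : Type v} [Field k] [Ring A] [Algebra k A] {B : Subalgebra k A}
  {M : Type*} [AddCommGroup M] [Module B M]

theorem Induced.mk_mul_tmul (a : A) (b : B) (m : M) :
    (Submodule.Quotient.mk ((a * (b : A)) ⊗ₜ[ℤ] m) : Induced B M) =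
      Submodule.Quotient.mk (a ⊗ₜ[ℤ] (b • m)) :=
  (Submodule.Quotient.eq _).2 (Submodule.subset_span ⟨a, b, m, rfl⟩)

theorem Induced.smul_mk_tmul (a a' : A) (m : M) :
    a • (Submodule.Quotient.mk (a' ⊗ₜ[ℤ] m) : Induced B M) =
      Submodule.Quotient.mk ((a * a') ⊗ₜ[ℤ] m) := by
  rw [← Submodule.Quotient.mk_smul, TensorProduct.smul_tmul', smul_eq_mul]

/-- If `g` generates `M` over `B`, then `1 ⊗ g` generates `A ⊗_B M` over `A`. -/
theorem Induced.span_mk_tmul {g : M} (hg : Submodule.span B {g} = ⊤) :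
    Submodule.span A {(Submodule.Quotient.mk ((1 : A) ⊗ₜ[ℤ] g) : Induced B M)} = ⊤ := by
  rw [eq_top_iff]
  rintro z -
  obtain ⟨z, rfl⟩ := Submodule.Quotient.mk_surjective _ z
  induction z with
  | zero => exact zero_mem _
  | add x y hx hy => exact add_mem hx hy
  | tmul a m =>
    obtain ⟨b, rfl⟩ := toSpanSingleton_surjective hg m
    rw [LinearMap.toSpanSingleton_apply, ← Induced.mk_mul_tmul]
    refine Submodule.mem_span_singleton.2 ⟨a * b, ?_⟩
    rw [Induced.smul_mk_tmul, mul_one]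

/-- Frobenius reciprocity: a `B`-linear map from `M` to an `A`-module `N` extends to `A ⊗_B M`. -/
theorem Induced.exists_lift {N : Type*} [AddCommGroup N] [Module A N] (φ : M →+ N)
    (hφ : ∀ (b : B) (m : M), φ (b • m) = (b : A) • φ m) :
    ∃ ψ : Induced B M →ₗ[A] N, ∀ a m, ψ (Submodule.Quotient.mk (a ⊗ₜ[ℤ] m)) = a • φ m := by
  let F : A ⊗[ℤ] M →ₗ[A] N := TensorProduct.AlgebraTensorModule.lift
    (LinearMap.toSpanSingleton A (M →ₗ[ℤ] N) φ.toIntLinearMap)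
  have hF : ∀ a m, F (a ⊗ₜ[ℤ] m) = a • φ m := fun a m => by simp [F]
  refine ⟨(balancingSubmodule B M).liftQ F (Submodule.span_le.2 ?_), fun a m => ?_⟩
  · rintro _ ⟨a, b, m, rfl⟩
    rw [SetLike.mem_coe, LinearMap.mem_ker, map_sub, hF, hF, hφ, smul_smul, sub_self]
  · exact hF a m

theorem Induced.exists_lift_of_generator {N : Type*} [AddCommGroup N] [Module A N] {g : M}
    (hg : Submodule.span B {g} = ⊤) {y : N} (h : ∀ b : B, b • g = 0 → (b : A) • y = 0) :
    ∃ ψ : Induced B M →ₗ[A] N, ∀ a, ψ (Submodule.Quotient.mk (a ⊗ₜ[ℤ] g)) = a • y := by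
  obtain ⟨φ, rfl⟩ := exists_linearMap_of_annihilator_le hg h
  obtain ⟨ψ, hψ⟩ := Induced.exists_lift φ.toAddMonoidHom fun b m => map_smul φ b m
  exact ⟨ψ, fun a => hψ a g⟩

theorem Induced.map_mk_tmul {M N : Type v} [AddCommGroup M] [Module B M] [AddCommGroup N]
    [Module B N] (f : M →ₗ[B] N) (a : A) (m : M) :
    Induced.map B f (Submodule.Quotient.mk (a ⊗ₜ[ℤ] m)) =
      Submodule.Quotient.mk (a ⊗ₜ[ℤ] f m) := rfl

end Induced

namespace IsTriangularBasis

variable {k : Type u} {A : Type v} [Field k] [Ring A] [Algebra k A] {ι : Type w} [Fintype ι]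
  {e : ι → A} {deg : ι → ℕ} {B : Subalgebra k A} {β : Type*} [Fintype β] {l : β → ι} {t : β → A}
  (T : IsTriangularBasis e deg B l t)

section Exact

variable (M : Type*) [AddCommGroup M] [Module B M]

/-- The map `A ⊗ M → M`, `a ⊗ m ↦ coord b a • m`; it gives the `b`-th component in the
decomposition of `A ⊗_B M` as the direct sum of the `t b ⊗ e (l b) M`. -/
noncomputable def tensorCoord (b : β) : A ⊗[ℤ] M →ₗ[ℤ] M :=
  TensorProduct.lift (LinearMap.mk₂ ℤ (fun a m => T.coord b a • m)
    (fun a a' m => by rw [map_add, add_smul])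
    (fun n a m => by rw [map_zsmul, smul_assoc])
    (fun a m m' => smul_add _ _ _)
    (fun n a m => smul_comm _ _ _))

variable {M}

theorem tensorCoord_tmul (b : β) (a : A) (m : M) :
    T.tensorCoord M b (a ⊗ₜ[ℤ] m) = T.coord b a • m := rfl

theorem tensorCoord_eq_zero {z : A ⊗[ℤ] M} (hz : z ∈ balancingSubmodule B M) (b : β) :
    T.tensorCoord M b z = 0 := by
  suffices h : ∀ a : A, T.tensorCoord M b (a • z) = 0 by simpa using h 1
  induction hz using Submodule.span_induction with
  | mem x hx =>
    obtain ⟨a', y, m, rfl⟩ := hx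
    intro a
    rw [smul_sub, TensorProduct.smul_tmul', TensorProduct.smul_tmul', map_sub, tensorCoord_tmul,
      tensorCoord_tmul, smul_eq_mul, smul_eq_mul, ← mul_assoc, T.coord_mul, smul_smul, sub_self]
  | zero => exact fun a => by rw [smul_zero, map_zero]
  | add x y _ _ hx hy => exact fun a => by rw [smul_add, map_add, hx, hy, add_zero]
  | smul a' x _ hx => exact fun a => by rw [smul_smul, hx]

theorem mk_eq_sum_tensorCoord (z : A ⊗[ℤ] M) :
    (Submodule.Quotient.mk z : Induced B M) =
      ∑ b, Submodule.Quotient.mk (t b ⊗ₜ[ℤ] T.tensorCoord M b z) := by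
  induction z with
  | zero => simp
  | add x y hx hy =>
    simp only [map_add, TensorProduct.tmul_add, Submodule.Quotient.mk_add, Finset.sum_add_distrib,
      hx, hy]
  | tmul a m =>
    conv_lhs => rw [← T.sum_coord a, TensorProduct.sum_tmul]
    rw [← Submodule.mkQ_apply, map_sum]
    exact Finset.sum_congr rfl fun b _ => Induced.mk_mul_tmul _ _ _

end Exact

section Map

variable {M N : Type v} [AddCommGroup M] [Module B M] [AddCommGroup N] [Module B N]

theorem tensorCoord_map (f : M →ₗ[B] N) (b : β) (z : A ⊗[ℤ] M) :
    T.tensorCoord N b (TensorProduct.AlgebraTensorModule.map (LinearMap.id : A →ₗ[A] A)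
      f.toAddMonoidHom.toIntLinearMap z) = f (T.tensorCoord M b z) := by
  induction z with
  | zero => simp
  | add x y hx hy => simp only [map_add, hx, hy]
  | tmul a m => exact (map_smul f _ _).symm

end Map

include T

/-- As `A` is a direct sum of direct summands of `B` as a right `B`-module, with coordinates that
are natural in the left module, `A ⊗_B -` is exact. -/
theorem inductionIsExact : InductionIsExact B := by
  intro M N Q _ _ _ _ _ _ f g hf hfg hg
  refine ⟨?_, fun z => ⟨fun hz => ?_, ?_⟩, fun z => ?_⟩
  · rw [← LinearMap.ker_eq_bot, eq_bot_iff]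
    intro z hz
    obtain ⟨z, rfl⟩ := Submodule.Quotient.mk_surjective _ z
    have hz' := (Submodule.Quotient.mk_eq_zero _).1 (show Submodule.Quotient.mk _ = _ from hz)
    rw [Submodule.mem_bot, T.mk_eq_sum_tensorCoord]
    refine Finset.sum_eq_zero fun b _ => ?_
    have h0 : f (T.tensorCoord M b z) = 0 := by
      rw [← T.tensorCoord_map]
      exact T.tensorCoord_eq_zero hz' b
    rw [hf (h0.trans (map_zero f).symm), TensorProduct.tmul_zero, Submodule.Quotient.mk_zero]
  · obtain ⟨z, rfl⟩ := Submodule.Quotient.mk_surjective _ z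
    have hz' := (Submodule.Quotient.mk_eq_zero _).1 (show Submodule.Quotient.mk _ = _ from hz)
    have h0 : ∀ b, ∃ m, f m = T.tensorCoord N b z := fun b => by
      refine (hfg _).1 ?_
      rw [← T.tensorCoord_map]
      exact T.tensorCoord_eq_zero hz' b
    choose m hm using h0
    refine ⟨∑ b, Submodule.Quotient.mk (t b ⊗ₜ[ℤ] m b), ?_⟩
    rw [map_sum, T.mk_eq_sum_tensorCoord z]
    exact Finset.sum_congr rfl fun b _ => by rw [Induced.map_mk_tmul, hm]
  · rintro ⟨y, rfl⟩
    obtain ⟨y, rfl⟩ := Submodule.Quotient.mk_surjective _ y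
    rw [T.mk_eq_sum_tensorCoord y, map_sum, map_sum]
    refine Finset.sum_eq_zero fun b _ => ?_
    rw [Induced.map_mk_tmul, Induced.map_mk_tmul, (hfg _).2 ⟨_, rfl⟩, TensorProduct.tmul_zero,
      Submodule.Quotient.mk_zero]
  · obtain ⟨z, rfl⟩ := Submodule.Quotient.mk_surjective _ z
    induction z with
    | zero => exact ⟨0, map_zero _⟩
    | add x y hx hy =>
      obtain ⟨x', hx'⟩ := hx
      obtain ⟨y', hy'⟩ := hy
      exact ⟨x' + y', by rw [map_add, hx', hy', Submodule.Quotient.mk_add]⟩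
    | tmul a m =>
      obtain ⟨n, rfl⟩ := hg m
      exact ⟨Submodule.Quotient.mk (a ⊗ₜ[ℤ] n), Induced.map_mk_tmul g a n⟩

/-! ### The exact Borel subalgebra -/

theorem coe_mem_lowerTrace {d : ℕ} {b : B} (hb : b ∈ lowerTrace B T.restrictIdem deg d) :
    (b : A) ∈ lowerTrace A e deg d := by
  induction hb using Submodule.span_induction with
  | mem x hx =>
    obtain ⟨j, hj, m, rfl⟩ := hx
    exact mul_mem_lowerTrace hj (m : A)
  | zero => exact zero_mem _
  | add x y _ _ hx hy => exact add_mem hx hy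
  | smul a x _ hx => exact (lowerTrace A e deg d).smul_mem (a : A) hx

/-- Modulo the lower ideal of `B`, the left ideal `B e i` is the line through `e i`. -/
theorem exists_mul_idem_sub_smul_mem (b : B) (i : ι) :
    ∃ c : k, b * T.restrictIdem i - c • T.restrictIdem i ∈
      lowerTrace B T.restrictIdem deg (deg i) := by
  obtain ⟨α, hα, hmem⟩ := T.restrict.exists_mul_idem_sub_sum_mem b i
  refine ⟨α i, ?_⟩
  rwa [Finset.sum_eq_single i (fun j _ hj => by rw [hα j hj, zero_smul])
    (fun h => absurd (Finset.mem_univ i) h)] at hmem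

theorem isSimpleModule_restrict_standard (i : ι) :
    IsSimpleModule B (DegreeStandard T.restrictIdem deg i) := by
  have H := T.restrict.isStratified
  have hne : standardGen T.restrictIdem deg i ≠ 0 := H.standardGen_ne_zero i
  have : Nontrivial (DegreeStandard T.restrictIdem deg i) := ⟨_, _, hne⟩
  refine isSimpleModule_iff_toSpanSingleton_surjective.2 ⟨this, fun x hx => ?_⟩
  refine toSpanSingleton_surjective ?_
  obtain ⟨b, rfl⟩ := toSpanSingleton_surjective (span_standardGen T.restrictIdem deg i) x
  obtain ⟨c, hc⟩ := T.exists_mul_idem_sub_smul_mem b i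
  have hb : b • standardGen T.restrictIdem deg i =
      algebraMap k B c • standardGen T.restrictIdem deg i := by
    rw [← sub_eq_zero, ← sub_smul, smul_standardGen_eq_zero_iff H.idem_mul, sub_mul,
      ← Algebra.smul_def]
    exact hc
  rw [LinearMap.toSpanSingleton_apply, hb] at hx ⊢
  have hc0 : c ≠ 0 := by
    rintro rfl
    exact hx (by rw [map_zero, zero_smul])
  rw [eq_top_iff, ← span_standardGen T.restrictIdem deg i, Submodule.span_singleton_le_iff_mem]
  refine Submodule.mem_span_singleton.2 ⟨algebraMap k B c⁻¹, ?_⟩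
  rw [smul_smul, ← map_mul, inv_mul_cancel₀ hc0, map_one, one_smul]

theorem smul_restrict_simpleGen_eq_zero_iff {b : B} {i : ι} :
    b • simpleGen T.restrictIdem deg i = 0 ↔
      b * T.restrictIdem i ∈ lowerTrace B T.restrictIdem deg (deg i) := by
  have H := T.restrict.isStratified
  refine ⟨fun h => ?_, smul_simpleGen_eq_zero H.idem_mul⟩
  obtain ⟨c, hc⟩ := T.exists_mul_idem_sub_smul_mem b i
  have h0 : (b - c • T.restrictIdem i) * T.restrictIdem i ∈
      lowerTrace B T.restrictIdem deg (deg i) := by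
    rwa [sub_mul, smul_mul_assoc, H.idem_mul i]
  have h1 := smul_simpleGen_eq_zero H.idem_mul h0
  rw [sub_smul, h, zero_sub, neg_eq_zero] at h1
  rwa [H.smul_idem_smul_simpleGen h1, zero_smul, sub_zero] at hc

/-- A `B`-module generated by an element with the annihilator of the generator of the simple
`B`-module at `i` induces the standard module at `i`: both are generated by an element whose
annihilator consists of the `a` with `a e i` in the lower ideal. -/
theorem nonempty_standard_equiv_induced {i : ι} {M : Type*} [AddCommGroup M] [Module B M] {g : M}
    (hg : Submodule.span B {g} = ⊤)
    (hann : ∀ b : B, b • g = 0 ↔ b * T.restrictIdem i ∈ lowerTrace B T.restrictIdem deg (deg i)) :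
    Nonempty (DegreeStandard e deg i ≃ₗ[A] Induced B M) := by
  have H := T.isStratified
  have hidem : T.restrictIdem i • g = g := by
    have h := (hann (1 - T.restrictIdem i)).2 (by
      rw [sub_mul, one_mul, T.restrict.idem_mul, sub_self]
      exact zero_mem _)
    rw [sub_smul, one_smul] at h
    exact (sub_eq_zero.1 h).symm
  obtain ⟨φ, -⟩ := exists_linearEquiv_of_annihilator_eq (span_standardGen e deg i)
    (Induced.span_mk_tmul (A := A) hg) fun a => by
      rw [smul_standardGen_eq_zero_iff H.idem_mul, Induced.smul_mk_tmul, mul_one]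
      constructor
      · intro h
        have h0 : (Submodule.Quotient.mk (a ⊗ₜ[ℤ] g) : Induced B M) =
            Submodule.Quotient.mk ((a * e i) ⊗ₜ[ℤ] g) := by
          conv_lhs => rw [← hidem]
          exact (Induced.mk_mul_tmul a (T.restrictIdem i) g).symm
        rw [h0, T.mk_eq_sum_tensorCoord]
        refine Finset.sum_eq_zero fun b _ => ?_
        suffices hb : T.coord b (a * e i) • g = 0 by
          rw [tensorCoord_tmul, hb, TensorProduct.tmul_zero, Submodule.Quotient.mk_zero]
        rcases lt_or_ge (deg (l b)) (deg i) with hd | hd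
        · have h2 : T.restrictIdem (l b) * T.coord b (a * e i) = T.coord b (a * e i) :=
            Subtype.ext (T.idem_mul_coord b _)
          rw [hann, ← h2, mul_assoc]
          exact mul_mem_lowerTrace hd _
        · rw [T.mem_lowerTrace_iff.1 h b hd, zero_smul]
      · intro h
        obtain ⟨ψ, hψ⟩ := Induced.exists_lift_of_generator (y := standardGen e deg i) hg
          fun b hb => (smul_standardGen_eq_zero_iff H.idem_mul (a := (b : A))).2
            (T.coe_mem_lowerTrace ((hann b).1 hb))
        rw [← smul_standardGen_eq_zero_iff H.idem_mul, ← hψ, h, map_zero]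
  exact ⟨φ⟩

/-- The subalgebra over which there is a triangular basis is an exact Borel subalgebra. -/
theorem isExactBorel [FiniteDimensional k A] :
    IsExactBorel (weightOrder deg) (degreeSimple e deg) B := by
  obtain ⟨P, p, hP, hPstd⟩ := T.isStratified.exists_isQuasiHereditaryWith
  obtain ⟨Q, q, hQ, hQstd⟩ := T.restrict.isStratified.exists_isQuasiHereditaryWith
  refine ⟨P, p, degreeSimple T.restrictIdem deg, Q, q, hP, hQ, fun i => ?_, T.inductionIsExact,
    fun i => ?_⟩
  · obtain ⟨φ⟩ := hQstd i
    have := T.isSimpleModule_restrict_standard i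
    exact IsSimpleModule.congr φ
  · obtain ⟨φ⟩ := hPstd i
    obtain ⟨ψ⟩ := T.nonempty_standard_equiv_induced (span_simpleGen T.restrictIdem deg i)
      fun b => T.smul_restrict_simpleGen_eq_zero_iff
    exact ⟨φ.trans ψ⟩

end IsTriangularBasis

/-! ### The triangular basis of a Reedy algebra -/

section Corner

variable {k : Type u} {A : Type v} [Field k] [Ring A] [Algebra k A]

theorem mul_mul_mem_corner {S : Subalgebra k A} {x y s : A} (hs : s ∈ S) :
    x * s * y ∈ corner S x y :=
  ⟨s, hs, rfl⟩

theorem mem_of_mem_corner {S : Subalgebra k A} {x y z : A} (hx : x ∈ S) (hy : y ∈ S)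
    (hz : z ∈ corner S x y) : z ∈ S := by
  obtain ⟨s, hs, rfl⟩ := hz
  exact S.mul_mem (S.mul_mem hx hs) hy

theorem mul_eq_of_mem_corner {S : Subalgebra k A} {x y z : A} (hx : x * x = x)
    (hz : z ∈ corner S x y) : x * z = z := by
  obtain ⟨s, -, rfl⟩ := hz
  simp only [LinearMap.mulLeftRight_apply, ← mul_assoc, hx]

theorem mul_eq_of_mem_corner_right {S : Subalgebra k A} {x y z : A} (hy : y * y = y)
    (hz : z ∈ corner S x y) : z * y = z := by
  obtain ⟨s, -, rfl⟩ := hz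
  simp only [LinearMap.mulLeftRight_apply, mul_assoc, hy]

theorem idem_mem_corner {S : Subalgebra k A} {x : A} (hx : x * x = x) : x ∈ corner S x x :=
  ⟨1, S.one_mem, by simp [hx]⟩

theorem eq_zero_of_mem_corner {S : Subalgebra k A} {x y z : A} (hx : x = 0)
    (hz : z ∈ corner S x y) : z = 0 := by
  obtain ⟨s, -, rfl⟩ := hz
  simp [hx]

theorem exists_eq_smul_of_mem_corner {S : Subalgebra k A} {x z : A} (hx : x * x = x) (hx0 : x ≠ 0)
    (h : Nonempty (↥(corner S x x) ≃ₗ[k] k)) (hz : z ∈ corner S x x) : ∃ c : k, z = c • x := by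
  obtain ⟨φ⟩ := h
  have h0 : φ ⟨x, idem_mem_corner hx⟩ ≠ 0 := fun h =>
    hx0 (congrArg Subtype.val (φ.map_eq_zero_iff.1 h))
  refine ⟨φ ⟨z, hz⟩ * (φ ⟨x, idem_mem_corner hx⟩)⁻¹, ?_⟩
  have : (⟨z, hz⟩ : ↥(corner S x x)) =
      (φ ⟨z, hz⟩ * (φ ⟨x, idem_mem_corner hx⟩)⁻¹) • ⟨x, idem_mem_corner hx⟩ := by
    apply φ.injective
    rw [map_smul, smul_eq_mul, mul_assoc, inv_mul_cancel₀ h0, mul_one]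
  exact congrArg Subtype.val this

end Corner

section PlusBasis

variable {k : Type u} {A : Type v} [Field k] [Ring A] [Algebra k A] {ι : Type w} (e : ι → A)
  (Ap : Subalgebra k A)

/-- The index set of the `k`-bases of all spaces `e j A⁺ e l`. -/
abbrev PlusIndex : Type w :=
  Σ j : ι, Σ l : ι, Fin (Module.finrank k ↥(corner Ap (e j) (e l)))

variable [FiniteDimensional k A]

/-- The `k`-bases of the spaces `e j A⁺ e l`, as a family of elements of `A`. -/
noncomputable def plusBasis (b : PlusIndex e Ap) : A :=
  (Module.finBasis k ↥(corner Ap (e b.1) (e b.2.1)) b.2.2 : A)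

variable {e Ap}

theorem plusBasis_mem (b : PlusIndex e Ap) : plusBasis e Ap b ∈ corner Ap (e b.1) (e b.2.1) :=
  Subtype.prop _

theorem sum_repr_plusBasis {j l : ι} {x : A} (hx : x ∈ corner Ap (e j) (e l)) :
    ∑ r, (Module.finBasis k ↥(corner Ap (e j) (e l))).repr ⟨x, hx⟩ r • plusBasis e Ap ⟨j, l, r⟩ =
      x := by
  have := congrArg (corner Ap (e j) (e l)).subtype
    ((Module.finBasis k ↥(corner Ap (e j) (e l))).sum_repr ⟨x, hx⟩)
  rwa [map_sum] at this

end PlusBasis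

namespace IsReedy

variable {k : Type u} {A : Type v} [Field k] [Ring A] [Algebra k A]
  {ι : Type w} [Fintype ι] {e : ι → A} {deg : ι → ℕ} {Ap Am : Subalgebra k A}
  (hA : IsReedy e deg Ap Am)

include hA

theorem idem_mul (i : ι) : e i * e i = e i := hA.idem.idem i

theorem idem_ne_zero (i : ι) : e i ≠ 0 := by
  intro h
  obtain ⟨φ⟩ := hA.plus_diag i
  have h0 : φ.symm 1 = 0 := Subtype.ext (eq_zero_of_mem_corner h (φ.symm 1).2)
  exact one_ne_zero (φ.symm.map_eq_zero_iff.1 h0)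

theorem sum_idem_mul_mul_idem (a : A) : ∑ j, ∑ i, e j * a * e i = a := by
  simp_rw [← Finset.mul_sum, ← Finset.sum_mul, hA.idem.complete, mul_one, one_mul]

variable [FiniteDimensional k A]

theorem mul_plusBasis (b : PlusIndex e Ap) :
    e b.1 * plusBasis e Ap b = plusBasis e Ap b :=
  mul_eq_of_mem_corner (hA.idem_mul _) (plusBasis_mem b)

theorem plusBasis_mul (b : PlusIndex e Ap) :
    plusBasis e Ap b * e b.2.1 = plusBasis e Ap b :=
  mul_eq_of_mem_corner_right (hA.idem_mul _) (plusBasis_mem b)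

theorem mul_plusBasis_of_ne {i : ι}
    {b : PlusIndex e Ap} (h : i ≠ b.1) :
    e i * plusBasis e Ap b = 0 := by
  rw [← hA.mul_plusBasis, ← mul_assoc, hA.idem.ortho h, zero_mul]

/-- Every element of `A` is a combination of the basis of `A⁺` with coefficients in `A⁻`, since
multiplication maps onto each `e j A e i`. -/
theorem exists_sum_plusBasis_mul (a : A) :
    ∃ c : PlusIndex e Ap → Am,
      ∑ b, plusBasis e Ap b * (c b : A) = a := by
  classical
  let Ψ : (PlusIndex e Ap → Am) →ₗ[k] A :=
    ∑ b, LinearMap.mulLeft k (plusBasis e Ap b) ∘ₗ Am.val.toLinearMap ∘ₗ LinearMap.proj b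
  have hΨ : ∀ c, Ψ c = ∑ b, plusBasis e Ap b * (c b : A) := fun c => by simp [Ψ]
  suffices h : a ∈ LinearMap.range Ψ by
    obtain ⟨c, hc⟩ := h
    exact ⟨c, (hΨ c).symm.trans hc⟩
  have hsingle : ∀ b (y : Am), plusBasis e Ap b * (y : A) ∈ LinearMap.range Ψ := fun b y => by
    refine ⟨Pi.single b y, ?_⟩
    rw [hΨ, Finset.sum_eq_single b]
    · rw [Pi.single_eq_same]
    · intro b' _ hb'
      rw [Pi.single_eq_of_ne hb', ZeroMemClass.coe_zero, mul_zero]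
    · simp
  rw [← hA.sum_idem_mul_mul_idem a]
  refine Submodule.sum_mem _ fun j _ => Submodule.sum_mem _ fun i _ => ?_
  have hmem : e j * a * e i ∈ LinearMap.range (triangularMul e Ap Am i j) := by
    rw [hA.mul_range]
    exact mul_mul_mem_corner Algebra.mem_top
  obtain ⟨z, hz⟩ := hmem
  rw [← hz, triangularMul, LinearMap.sum_apply]
  refine Submodule.sum_mem _ fun l _ => ?_
  rw [LinearMap.comp_apply, LinearMap.proj_apply]
  induction z l with
  | zero => rw [map_zero]; exact zero_mem _
  | add x y hx hy => rw [map_add]; exact add_mem hx hy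
  | tmul x y =>
    rw [Submodule.mulMap_tmul, ← sum_repr_plusBasis x.2, Finset.sum_mul]
    refine Submodule.sum_mem _ fun r _ => ?_
    rw [smul_mul_assoc]
    exact Submodule.smul_mem _ _ (hsingle ⟨j, l, r⟩
      ⟨y, mem_of_mem_corner (hA.mem_minus l) (hA.mem_minus i) y.2⟩)

/-- The coefficients are unique, since multiplication is injective on each
`⨁ l, e j A⁺ e l ⊗ e l A⁻ e i`. -/
theorem eq_zero_of_sum_plusBasis_mul
    (c : PlusIndex e Ap → Am)
    (hc : ∀ b, e b.2.1 * (c b : A) = c b) (hsum : ∑ b, plusBasis e Ap b * (c b : A) = 0) :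
    ∀ b, c b = 0 := by
  rintro ⟨j, l, r⟩
  have key : ∀ i, (c ⟨j, l, r⟩ : A) * e i = 0 := by
    intro i
    have hmem : ∀ l r, (c ⟨j, l, r⟩ : A) * e i ∈ corner Am (e l) (e i) := fun l r => by
      rw [← hc]
      exact mul_mul_mem_corner (c ⟨j, l, r⟩).2
    let z : ∀ l : ι, ↥(corner Ap (e j) (e l)) ⊗[k] ↥(corner Am (e l) (e i)) := fun l =>
      ∑ r, Module.finBasis k ↥(corner Ap (e j) (e l)) r ⊗ₜ[k] ⟨(c ⟨j, l, r⟩ : A) * e i, hmem l r⟩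
    have hz : triangularMul e Ap Am i j z = 0 := by
      have h1 : triangularMul e Ap Am i j z =
          ∑ l, ∑ r, plusBasis e Ap ⟨j, l, r⟩ * ((c ⟨j, l, r⟩ : A) * e i) := by
        simp [triangularMul, z, plusBasis]
      have h2 : e j * (∑ b, plusBasis e Ap b * (c b : A)) * e i =
          ∑ l, ∑ r, plusBasis e Ap ⟨j, l, r⟩ * ((c ⟨j, l, r⟩ : A) * e i) := by
        rw [Finset.mul_sum, Finset.sum_mul, Fintype.sum_sigma, Finset.sum_eq_single j]
        · rw [Fintype.sum_sigma]
          refine Finset.sum_congr rfl fun l _ => Finset.sum_congr rfl fun r _ => ?_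
          rw [← mul_assoc, hA.mul_plusBasis ⟨j, l, r⟩, mul_assoc]
        · intro j' _ hj'
          refine Finset.sum_eq_zero fun b _ => ?_
          rw [← mul_assoc, hA.mul_plusBasis_of_ne (b := ⟨j', b⟩) hj'.symm, zero_mul, zero_mul]
        · simp
      rw [h1, ← h2, hsum, mul_zero, zero_mul]
    have hz0 : z = 0 := hA.mul_injective i j (hz.trans (map_zero _).symm)
    have hzl : z l = 0 := congrFun hz0 l
    have := congrArg (fun y => TensorProduct.lid k _ (LinearMap.rTensor ↥(corner Am (e l) (e i))
      ((Module.finBasis k ↥(corner Ap (e j) (e l))).coord r) y)) hzl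
    simp only [z, map_sum, LinearMap.rTensor_tmul, TensorProduct.lid_tmul, map_zero,
      Module.Basis.coord_apply, Module.Basis.repr_self] at this
    rw [Finset.sum_eq_single r (fun r' _ h => by rw [Finsupp.single_eq_of_ne h.symm, zero_smul])
      (by simp), Finsupp.single_eq_same, one_smul] at this
    exact congrArg Subtype.val this
  apply Subtype.ext
  rw [← mul_one (c ⟨j, l, r⟩ : A), ← hA.idem.complete, Finset.mul_sum]
  exact Finset.sum_eq_zero fun i _ => key i

/-- The degree conditions on `A⁺` and `A⁻` turn the bases of the `e j A⁺ e l` into a triangular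
basis of `A` over `A⁻`. -/
theorem isTriangularBasis :
    IsTriangularBasis e deg Am (fun b => b.2.1) (plusBasis e Ap) where
  idem := hA.idem
  ne_zero := hA.idem_ne_zero
  mem := hA.mem_minus
  minus_diag i x hx :=
    exists_eq_smul_of_mem_corner (hA.idem_mul i) (hA.idem_ne_zero i) (hA.minus_diag i)
      (mul_mul_mem_corner hx)
  minus_deg i j x hx hji hdeg := by
    by_contra hne
    refine absurd (hA.minus_deg i j hji.symm fun h => hne ?_) hdeg.not_gt
    exact (Submodule.eq_bot_iff _).1 h _ (mul_mul_mem_corner hx)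
  mul_idem := hA.plusBasis_mul
  plus_diag := by
    rintro ⟨j, l, r⟩
    by_cases h : l = j
    · subst h
      obtain ⟨c, hc⟩ := exists_eq_smul_of_mem_corner (hA.idem_mul l) (hA.idem_ne_zero l)
        (hA.plus_diag l) (plusBasis_mem ⟨l, l, r⟩)
      exact ⟨c, by rw [hA.mul_plusBasis ⟨l, l, r⟩, hc]⟩
    · exact ⟨0, by rw [hA.mul_plusBasis_of_ne (b := ⟨j, l, r⟩) h, zero_smul]⟩
  plus_deg := by
    rintro i ⟨j, l, r⟩ hil hdeg
    by_cases h : i = j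
    · subst h
      by_contra hne
      refine absurd (hA.plus_deg l i hil.symm fun h => hne ?_) hdeg.not_gt
      rw [hA.mul_plusBasis ⟨i, l, r⟩]
      exact (Submodule.eq_bot_iff _).1 h _ (plusBasis_mem ⟨i, l, r⟩)
    · exact hA.mul_plusBasis_of_ne (b := ⟨j, l, r⟩) h
  idem_eq_sum i := by
    have hmem : ∀ j l, e j * e i * e l ∈ corner Ap (e j) (e l) := fun j l =>
      mul_mul_mem_corner (hA.mem_plus i)
    refine ⟨fun b => (Module.finBasis k ↥(corner Ap (e b.1) (e b.2.1))).repr ⟨_, hmem _ _⟩ b.2.2,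
      fun b hb => ?_, ?_⟩
    · have h0 : e b.1 * e i * e b.2.1 = 0 := by
        rw [mul_assoc, hA.idem.ortho (Ne.symm hb), mul_zero]
      have : (⟨_, hmem b.1 b.2.1⟩ : ↥(corner Ap (e b.1) (e b.2.1))) = 0 := Subtype.ext h0
      beta_reduce
      rw [this, map_zero, Finsupp.zero_apply]
    · conv_rhs => rw [← hA.sum_idem_mul_mul_idem (e i)]
      rw [Fintype.sum_sigma]
      refine Finset.sum_congr rfl fun j _ => ?_
      rw [Fintype.sum_sigma]
      exact Finset.sum_congr rfl fun l _ => sum_repr_plusBasis (hmem j l)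
  exists_coord a := by
    obtain ⟨c, hc⟩ := hA.exists_sum_plusBasis_mul a
    refine ⟨fun b => ⟨e b.2.1, hA.mem_minus _⟩ * c b, fun b => ?_, ?_⟩
    · rw [MulMemClass.coe_mul, ← mul_assoc, hA.idem_mul]
    · rw [← hc]
      refine Finset.sum_congr rfl fun b _ => ?_
      rw [MulMemClass.coe_mul, ← mul_assoc, hA.plusBasis_mul]
  coord_unique := hA.eq_zero_of_sum_plusBasis_mul

end IsReedy

end ReedyAlg

theorem mainTheorem3 {k : Type u} {A : Type v} [Field k] [Ring A] [Algebra k A]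
    [FiniteDimensional k A] {ι : Type w} [Fintype ι] (e : ι → A) (deg : ι → ℕ)
    (Ap Am : Subalgebra k A) (hA : ReedyAlg.IsReedy e deg Ap Am) :
    (∀ i, ∃! N : Submodule A (ReedyAlg.DegreeStandard e deg i), IsCoatom N) ∧
    ReedyAlg.IsQuasiHereditary (ReedyAlg.weightOrder deg) (ReedyAlg.degreeSimple e deg) ∧
    ReedyAlg.IsExactBorel (ReedyAlg.weightOrder deg) (ReedyAlg.degreeSimple e deg) Am := by
  have T := hA.isTriangularBasis
  obtain ⟨P, p, hP, -⟩ := T.isStratified.exists_isQuasiHereditaryWith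
  exact ⟨T.isStratified.existsUnique_isCoatom, ⟨P, p, hP⟩, T.isExactBorel⟩
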